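/- Let $S^2\subset\mathbb R^3$ be the unit sphere with poles $(0,0,\pm1)$; a longitude is an open great semicircle joining the poles. Let $G$ be a simple graph with $n\ge 4$ vertices. A shortest-path drawing of $G$ on $S^2$ draws every edge as a great-circular arc of length less than $\pi$; it is an embedding if it is injective. A (generic shortest-path) triangulation is a shortest-path embedding $\Gamma$ of $G$ such that every face (component of the complement) is bounded by a cycle of three distinct edges, no great circle contains more than two vertices, and no great circle through the poles contains more than one vertex. (So $G$ is maximal planar.) A face is non-polar if it contains neither pole. A drawing is southern if every vertex lies strictly below the equator $z=0$. For corners $(i,j,k)$ of a face of $\Gamma$, the sign of $\det(p_i,p_j,p_k)$ of the vertex positions in a drawing is its orientation there; the face is degenerate there if this determinant is $0$. Two triangulations of $G$ are $\theta$-equivalent if they define the same rotation system and every vertex lies on the same longitude in both. A longitudinal morph from $\Gamma$ to $\Gamma'$ is a continuous map $H:[0,1]\times G\to S^2$ with $H(0,\cdot)=\Gamma$ and $H(1,\cdot)=\Gamma'$ such that every $H(t,\cdot)$ is a shortest-path embedding and every vertex stays on its longitude. $\Gamma$ is sinkable if there is a longitudinal morph from $\Gamma$ to a $\theta$-equivalent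 southern triangulation. A weak triangulation (relative to the faces of $\Gamma$) is a shortest-path drawing $\Gamma'$ of $G$ that may have degenerate faces, but has no crossing edges (two edges whose interiors meet lie on a common great circle) and no inverted faces (with corners listed counterclockwise around each face of $\Gamma$, the determinant in $\Gamma'$ is non-negative for all faces except at most one, which may be everted, i.e. drawn as the complement of the small triangle with its corners). It is $\theta$-equivalent to $\Gamma$ if every vertex lies on the same longitude in $\Gamma$ and $\Gamma'$, and every non-polar face of $\Gamma$ that is non-degenerate in $\Gamma'$ has the same orientation in $\Gamma'$ as in $\Gamma$. **Corollary.** A triangulation $\Gamma$ is sinkable if and only if there is a southern weak triangulation that is $\theta$-equivalent to $\Gamma$. -/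

import Mathlib

open Set Filter Topology

namespace SphereDrawing

/-! ## The sphere -/

/-- Euclidean 3-space. -/
abbrev E3 : Type := EuclideanSpace ℝ (Fin 3)

/-- The unit sphere; coordinates of `x : S2` are `x.1 0`, `x.1 1`, `x.1 2`. -/
abbrev S2 : Type := Metric.sphere (0 : E3) 1

/-- The north pole `(0,0,1)`. -/
noncomputable def northPole : S2 := ⟨EuclideanSpace.single 2 1, by simp⟩

/-- The south pole `(0,0,-1)`. -/
noncomputable def southPole : S2 := -northPole

/-- The longitude at angle `φ`: the open great semicircle between the two poles through
`(cos φ, sin φ, 0)`. -/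
def longitude (φ : ℝ) : Set S2 :=
  {x | ∃ r : ℝ, 0 < r ∧ x.1 0 = r * Real.cos φ ∧ x.1 1 = r * Real.sin φ}

/-- The two points lie on a common longitude (in particular neither is a pole). -/
def SameLongitude (x y : S2) : Prop := ∃ φ : ℝ, x ∈ longitude φ ∧ y ∈ longitude φ

/-- The determinant with rows `a`, `b`, `c`. For points of the sphere it vanishes iff they lie on a
common great circle, and it is positive iff `c` is strictly to the left of the directed
great circle from `a` to `b`, seen from outside the sphere. -/
def orient (a b c : E3) : ℝ :=
  Matrix.det !![a 0, a 1, a 2; b 0, b 1, b 2; c 0, c 1, c 2]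

/-- The shortest great-circular arc from `a` to `b` (used for `a ≠ -b`), with its endpoints. -/
def arc (a b : S2) : Set S2 :=
  {x | ∃ s t : ℝ, 0 ≤ s ∧ 0 ≤ t ∧ x.1 = s • a.1 + t • b.1}

/-- The same arc without its endpoints. -/
def openArc (a b : S2) : Set S2 :=
  {x | ∃ s t : ℝ, 0 < s ∧ 0 < t ∧ x.1 = s • a.1 + t • b.1}

/-! ## Graphs as topological spaces, and their drawings -/

variable {n : ℕ}

/-- The geometric realization of `G` as a one-dimensional complex, in barycentric coordinates:
convex combinations of the vertices supported on a single vertex or on a single edge. -/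
abbrev Realization (G : SimpleGraph (Fin n)) : Type :=
  {w : Fin n → ℝ // w ∈ stdSimplex ℝ (Fin n) ∧
    ∃ u v : Fin n, (u = v ∨ G.Adj u v) ∧ ∀ x, w x ≠ 0 → x = u ∨ x = v}

/-- The vertex `v` as a point of the realization. -/
def vertex (G : SimpleGraph (Fin n)) (v : Fin n) : Realization G :=
  ⟨Pi.single v 1, single_mem_stdSimplex ℝ v, v, v, Or.inl rfl, fun x hx => by
    by_contra h
    exact hx (Pi.single_eq_of_ne (fun e => h (Or.inl e)) 1)⟩

/-- The closed edge between the adjacent vertices `u` and `v`. -/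
def edge (G : SimpleGraph (Fin n)) (u v : Fin n) : Set (Realization G) :=
  {w | ∀ x, w.1 x ≠ 0 → x = u ∨ x = v}

variable {G : SimpleGraph (Fin n)}

/-- The position of the vertex `v` in the drawing `Γ`. -/
def pos (Γ : Realization G → S2) (v : Fin n) : S2 := Γ (vertex G v)

/-- A drawing of `G` in which every edge is drawn as a great-circular arc of length less
than `π`. Different edges may meet. -/
structure IsShortestPathDrawing (Γ : Realization G → S2) : Prop where
  continuous : Continuous Γ
  not_antipodal : ∀ u v, G.Adj u v → pos Γ u ≠ -pos Γ v
  simple_edge : ∀ u v, G.Adj u v → InjOn Γ (edge G u v)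
  edge_eq_arc : ∀ u v, G.Adj u v → Γ '' edge G u v = arc (pos Γ u) (pos Γ v)

/-- An embedding of `G` whose edges are shortest paths. -/
structure IsShortestPathEmbedding (Γ : Realization G → S2) : Prop
    extends IsShortestPathDrawing Γ where
  injective : Function.Injective Γ

/-! ## Faces -/

/-- `U` is a face of `Γ`: a connected component of the complement of the drawing. -/
def IsFace (Γ : Realization G → S2) (U : Set S2) : Prop :=
  ∃ x ∈ (range Γ)ᶜ, U = connectedComponentIn (range Γ)ᶜ x

/-- The boundary of `U` is the cycle formed by the three edges `ij`, `jk`, `ki` of `G`. -/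
def BoundedBy (Γ : Realization G → S2) (U : Set S2) (i j k : Fin n) : Prop :=
  G.Adj i j ∧ G.Adj j k ∧ G.Adj k i ∧
    frontier U = Γ '' edge G i j ∪ Γ '' edge G j k ∪ Γ '' edge G k i

/-- `U` lies immediately to the left of the edge directed from `i` to `j`. -/
def IsLeftOf (Γ : Realization G → S2) (U : Set S2) (i j : Fin n) : Prop :=
  ∀ m ∈ openArc (pos Γ i) (pos Γ j),
    ∀ᶠ x : S2 in 𝓝 m, 0 < orient (pos Γ i).1 (pos Γ j).1 x.1 → x ∈ U

/-- `(i,j,k)` is a face of `Γ`, listed counterclockwise around its interior `U`. -/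
def IsCcwFace (Γ : Realization G → S2) (U : Set S2) (i j k : Fin n) : Prop :=
  IsFace Γ U ∧ BoundedBy Γ U i j k ∧ IsLeftOf Γ U i j ∧ IsLeftOf Γ U j k ∧ IsLeftOf Γ U k i

/-- The region `U` contains neither pole. -/
def IsNonPolar (U : Set S2) : Prop := northPole ∉ U ∧ southPole ∉ U

/-! ## Triangulations -/

/-- A generic shortest-path triangulation of the sphere. -/
structure IsTriangulation (Γ : Realization G → S2) : Prop
    extends IsShortestPathEmbedding Γ where
  /-- every face is bounded by a cycle of three distinct edges -/
  faces : ∀ U, IsFace Γ U → ∃ i j k, BoundedBy Γ U i j k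
  /-- no great circle contains more than two vertices -/
  generic : ∀ u v w, u ≠ v → v ≠ w → u ≠ w →
    orient (pos Γ u).1 (pos Γ v).1 (pos Γ w).1 ≠ 0
  /-- no great circle through the poles contains more than one vertex -/
  generic_poles : ∀ u v, u ≠ v → orient northPole.1 (pos Γ u).1 (pos Γ v).1 ≠ 0

/-- Every vertex lies below the equator. -/
def IsSouthern (Γ : Realization G → S2) : Prop := ∀ v, (pos Γ v).1 2 < 0

/-- The unit tangent vector at `u` of the great-circular arc that leaves `u` towards `a`. -/
noncomputable def direction (u a : S2) : E3 :=
  (‖a.1 - inner ℝ u.1 a.1 • u.1‖)⁻¹ • (a.1 - inner ℝ u.1 a.1 • u.1)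

/-- The arcs from `u` to `a`, `b`, `c` leave `u` in this counterclockwise cyclic order: their three
unit directions form a counterclockwise triangle in the tangent plane at `u`. -/
def IsCcwAround (u a b c : S2) : Prop :=
  0 < orient u.1 (direction u b - direction u a) (direction u c - direction u a)

/-- Two shortest-path embeddings are isomorphic: they define the same rotation system, that is,
the same counterclockwise cyclic order of the neighbours around every vertex. -/
def Isomorphic (Γ Γ' : Realization G → S2) : Prop :=
  ∀ u a b c, G.Adj u a → G.Adj u b → G.Adj u c →
    (IsCcwAround (pos Γ u) (pos Γ a) (pos Γ b) (pos Γ c) ↔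
      IsCcwAround (pos Γ' u) (pos Γ' a) (pos Γ' b) (pos Γ' c))

/-- `θ`-equivalence of triangulations. -/
def ThetaEquivalent (Γ Γ' : Realization G → S2) : Prop :=
  Isomorphic Γ Γ' ∧ ∀ v, SameLongitude (pos Γ v) (pos Γ' v)

/-! ## Morphs and sinkability -/

/-- `H` is a morph from `Γ` to `Γ'`: an isotopy through shortest-path embeddings. -/
structure IsMorph (H : unitInterval × Realization G → S2) (Γ Γ' : Realization G → S2) :
    Prop where
  continuous : Continuous H
  source : ∀ w, H (0, w) = Γ w
  target : ∀ w, H (1, w) = Γ' w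
  embedding : ∀ t, IsShortestPathEmbedding (fun w => H (t, w))

/-- A morph in which the vertices move only along their longitudes. -/
structure IsLongitudinalMorph (H : unitInterval × Realization G → S2)
    (Γ Γ' : Realization G → S2) : Prop extends IsMorph H Γ Γ' where
  same_longitude : ∀ t v, SameLongitude (pos Γ v) (H (t, vertex G v))

/-- `Γ` can be longitudinally morphed to a `θ`-equivalent triangulation with all vertices below
the equator. -/
def Sinkable (Γ : Realization G → S2) : Prop :=
  ∃ Γ' : Realization G → S2, IsTriangulation Γ' ∧ ThetaEquivalent Γ Γ' ∧ IsSouthern Γ' ∧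
    ∃ H, IsLongitudinalMorph H Γ Γ'

/-! ## Weak triangulations -/

/-- No two edges cross: whenever two open edges meet, they lie on one great circle. -/
def NoCrossingEdges (Γ' : Realization G → S2) : Prop :=
  ∀ u v x y, G.Adj u v → G.Adj x y →
    (openArc (pos Γ' u) (pos Γ' v) ∩ openArc (pos Γ' x) (pos Γ' y)).Nonempty →
    orient (pos Γ' u).1 (pos Γ' v).1 (pos Γ' x).1 = 0 ∧
      orient (pos Γ' u).1 (pos Γ' v).1 (pos Γ' y).1 = 0

/-- No face of `G` is inverted in the drawing `Γ'`, where the faces of `G` and their orientations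
are those of the triangulation `Γ` of `G`. A face `(i,j,k)`, listed counterclockwise, is drawn as
the small triangle with these corners when `0 < orient`, is degenerate when `orient = 0`, and when
`orient < 0` it is either inverted or everted, i.e. drawn as the complement of the small triangle.
At most one face of a drawing can be everted. -/
def NoInvertedFaces (Γ Γ' : Realization G → S2) : Prop :=
  ∃ a b c : Fin n, ∀ U i j k, IsCcwFace Γ U i j k → ({i, j, k} : Set (Fin n)) ≠ {a, b, c} →
    0 ≤ orient (pos Γ' i).1 (pos Γ' j).1 (pos Γ' k).1

/-- `Γ'` is a weak triangulation of `G`: a shortest-path drawing that may include degenerate faces,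
but no inverted faces and no crossing edges. -/
structure IsWeakTriangulation (Γ Γ' : Realization G → S2) : Prop
    extends IsShortestPathDrawing Γ' where
  no_inverted_faces : NoInvertedFaces Γ Γ'
  no_crossing_edges : NoCrossingEdges Γ'

/-- `θ`-equivalence of a weak triangulation `Γ'` to the triangulation `Γ`: the vertices lie on the
same longitudes, and every non-polar face that is non-degenerate in `Γ'` has the same orientation
in `Γ'` as in `Γ`. -/
def WeakThetaEquivalent (Γ Γ' : Realization G → S2) : Prop :=
  (∀ v, SameLongitude (pos Γ v) (pos Γ' v)) ∧
    ∀ U i j k, IsFace Γ U → BoundedBy Γ U i j k → IsNonPolar U →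
      orient (pos Γ' i).1 (pos Γ' j).1 (pos Γ' k).1 ≠ 0 →
      SignType.sign (orient (pos Γ' i).1 (pos Γ' j).1 (pos Γ' k).1) =
        SignType.sign (orient (pos Γ i).1 (pos Γ j).1 (pos Γ k).1)

end SphereDrawing

namespace SphereDrawing

/-! ## Linear algebra -/

/-! Only rays from the origin matter for a drawing. Moving a vertex along its longitude therefore
amounts to replacing its position `p v` by `p v + k v • axis` and projecting back to the sphere, so
longitudinal motions are vectors `k` of real numbers. Since a determinant with two rows along the
axis vanishes, the orientation of a shifted triple is affine in `k` (`orient_add_axis`). The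
requirement that all non-polar faces keep their orientation (`IsAdmissible`) is thus a finite system
of strict affine inequalities, whose solution set is open, convex and contains `0`.

The core is that these inequalities suffice for an embedding. Extend a shift linearly along the
edges, which keeps every edge a great-circular arc. Two consecutive points of the drawing on one
longitude lie on a common non-polar face (`exists_face_of_consecutive`), and Cramer's rule shows
that the sign of that face's shifted determinant decides whether the two points keep their order
(`above_lift_of_consecutive`). A longitude meets the drawing in finitely many points, so induction
gives the order of all of them (`above_lift`), and with it injectivity. The same order argument
carries each face to a face, so a shift in general position is again a triangulation
(`isTriangulation_shiftDrawing`).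

From weak to sinkable: the vertices of a southern weak triangulation give a shift `k` satisfying the
inequalities weakly. Scaling it by a factor slightly below 1 makes them strict, because `0`
satisfies them strictly; a small perturbation then achieves general position, still below the
equator. The segment from `0` to this shift is the morph, and continuity preserves the rotation
system (`IsMorph.isomorphic`).

From sinkable to weak: the end of the morph serves. A non-polar face cannot degenerate on the way,
since one corner would land on the opposite edge (`orient_ne_zero_of_isNonPolar`), so its
orientation persists. The face of the north pole is the one allowed to be everted, and a face
holding only the south pole is positive because all heights are negative. -/

theorem orient_eq (a b c : E3) : orient a b c =
    a 0 * (b 1 * c 2 - b 2 * c 1) - a 1 * (b 0 * c 2 - b 2 * c 0)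
      + a 2 * (b 0 * c 1 - b 1 * c 0) := by
  simp only [orient, Matrix.det_fin_three]
  simp
  ring

theorem orient_cycle (a b c : E3) : orient a b c = orient b c a := by
  simp only [orient_eq]; ring

theorem orient_add_left (a a' b c : E3) :
    orient (a + a') b c = orient a b c + orient a' b c := by
  simp only [orient_eq, PiLp.add_apply]; ring

theorem orient_smul_left (s : ℝ) (a b c : E3) : orient (s • a) b c = s * orient a b c := by
  simp only [orient_eq, PiLp.smul_apply, smul_eq_mul]; ring

theorem orient_add_mid (a b b' c : E3) :
    orient a (b + b') c = orient a b c + orient a b' c := by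
  simp only [orient_eq, PiLp.add_apply]; ring

theorem orient_smul_mid (s : ℝ) (a b c : E3) : orient a (s • b) c = s * orient a b c := by
  simp only [orient_eq, PiLp.smul_apply, smul_eq_mul]; ring

theorem orient_add_right (a b c c' : E3) :
    orient a b (c + c') = orient a b c + orient a b c' := by
  simp only [orient_eq, PiLp.add_apply]; ring

theorem orient_smul_right (s : ℝ) (a b c : E3) : orient a b (s • c) = s * orient a b c := by
  simp only [orient_eq, PiLp.smul_apply, smul_eq_mul]; ring

@[simp] theorem orient_self_left (a b : E3) : orient a a b = 0 := by
  simp only [orient_eq]; ring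

@[simp] theorem orient_self_right (a b : E3) : orient a b b = 0 := by
  simp only [orient_eq]; ring

@[simp] theorem orient_self_outer (a b : E3) : orient a b a = 0 := by
  simp only [orient_eq]; ring

theorem continuous_orient {X : Type*} [TopologicalSpace X] {f g h : X → E3}
    (hf : Continuous f) (hg : Continuous g) (hh : Continuous h) :
    Continuous fun x => orient (f x) (g x) (h x) := by
  simp only [orient_eq]; fun_prop

/-- Cramer's rule. -/
theorem orient_smul_eq (a b c x : E3) : orient a b c • x =
    orient x b c • a + orient x c a • b + orient x a b • c := by
  ext i
  fin_cases i <;> simp [orient_eq] <;> ring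

/-- The unit vector towards the north pole. -/
noncomputable abbrev axis : E3 := EuclideanSpace.single 2 1

theorem orient_axis (a b : E3) : orient axis a b = a 0 * b 1 - a 1 * b 0 := by
  simp [orient_eq]

/-- Expansion along the heights. The axis determinants depend only on horizontal coordinates, so
below the equator their signs control the orientation of the face at the south pole. -/
theorem orient_expand_axis (a b c : E3) : orient a b c =
    a 2 * orient axis b c + b 2 * orient axis c a + c 2 * orient axis a b := by
  simp only [orient_axis]; simp only [orient_eq]; ring

/-- By multilinearity, every term with two rows along the axis vanishes; this makes orientation
affine in the shifts. -/
theorem orient_add_axis (a b c : E3) (x y z : ℝ) :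
    orient (a + x • axis) (b + y • axis) (c + z • axis) = orient a b c +
      (x * orient axis b c + y * orient axis c a + z * orient axis a b) := by
  simp only [orient_axis]; simp [orient_eq]; ring

/-- `b` lies above `a` on the same half-plane bounded by the axis, where `P` points up. -/
def Above (P a b : E3) : Prop := ∃ ρ δ : ℝ, 0 < ρ ∧ 0 < δ ∧ ρ • b = a + δ • P

theorem Above.trans {P a b c : E3} (h : Above P a b) (h' : Above P b c) : Above P a c := by
  obtain ⟨ρ, δ, hρ, hδ, h⟩ := h
  obtain ⟨ρ', δ', hρ', hδ', h'⟩ := h'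
  refine ⟨ρ * ρ', δ + ρ * δ', by positivity, by positivity, ?_⟩
  rw [mul_smul, h', smul_add, h]; module

theorem above_neg {P a b : E3} : Above (-P) a b ↔ Above P b a := by
  have key : ∀ {P a b : E3}, Above P a b → Above (-P) b a := by
    rintro P a b ⟨ρ, δ, hρ, hδ, h⟩
    refine ⟨ρ⁻¹, ρ⁻¹ * δ, by positivity, by positivity, ?_⟩
    have : a = ρ • b - δ • P := by rw [h]; module
    rw [this, smul_sub, smul_smul, inv_mul_cancel₀ hρ.ne']; module
  exact ⟨fun h => by simpa using key h, key⟩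

theorem Above.smul {P a b : E3} (h : Above P a b) {s t : ℝ} (hs : 0 < s) (ht : 0 < t) :
    Above P (s • a) (t • b) := by
  obtain ⟨ρ, δ, hρ, hδ, h⟩ := h
  refine ⟨s * ρ / t, s * δ, by positivity, by positivity, ?_⟩
  rw [smul_smul, div_mul_cancel₀ _ ht.ne', mul_smul, h]; module

theorem smul_eq_add_axis_iff {a b : E3} {ρ δ : ℝ} : ρ • b = a + δ • axis ↔
    ρ * b 0 = a 0 ∧ ρ * b 1 = a 1 ∧ ρ * b 2 = a 2 + δ := by
  constructor
  · intro h
    have h0 := congrArg (fun x : E3 => x 0) h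
    have h1 := congrArg (fun x : E3 => x 1) h
    have h2 := congrArg (fun x : E3 => x 2) h
    simpa using And.intro h0 (And.intro h1 h2)
  · rintro ⟨h0, h1, h2⟩
    ext i
    fin_cases i <;> simp [h0, h1, h2]

/-- The point is not on the axis. -/
def OffAxis (a : E3) : Prop := a 0 ≠ 0 ∨ a 1 ≠ 0

theorem OffAxis.ne_zero {a : E3} (h : OffAxis a) : a ≠ 0 := by
  rintro rfl; simp [OffAxis] at h

theorem OffAxis.add_axis {a : E3} (h : OffAxis a) (s : ℝ) : OffAxis (a + s • axis) := by
  simpa [OffAxis] using h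

theorem OffAxis.smul {a : E3} (h : OffAxis a) {s : ℝ} (hs : s ≠ 0) : OffAxis (s • a) := by
  simpa [OffAxis, hs] using h

theorem offAxis_of_orient {a b : E3} (h : orient axis a b ≠ 0) : OffAxis a := by
  by_contra hc
  simp only [OffAxis, not_or, not_not] at hc
  simp [orient_axis, hc.1, hc.2] at h

/-- A nonzero horizontal coordinate forces `ρ = 1`, hence `δ = 0`. On the axis this fails: the pole
direction is above itself with `ρ = 1 + δ`. -/
theorem not_above_self {a : E3} (h : OffAxis a) : ¬ Above axis a a := by
  rintro ⟨ρ, δ, hρ, hδ, e⟩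
  obtain ⟨h0, h1, h2⟩ := smul_eq_add_axis_iff.1 e
  have : ρ = 1 := by
    rcases h with h | h
    · exact mul_right_cancel₀ h (by linarith)
    · exact mul_right_cancel₀ h (by linarith)
  subst this
  linarith

/-- `a` and `b` lie on the same open half-plane bounded by the axis. -/
def SameSide (a b : E3) : Prop := ∃ ρ δ : ℝ, 0 < ρ ∧ ρ • b = a + δ • axis

theorem Above.sameSide {a b : E3} (h : Above axis a b) : SameSide a b := by
  obtain ⟨ρ, δ, hρ, -, h⟩ := h
  exact ⟨ρ, δ, hρ, h⟩

theorem SameSide.symm {a b : E3} (h : SameSide a b) : SameSide b a := by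
  obtain ⟨ρ, δ, hρ, h⟩ := h
  refine ⟨ρ⁻¹, -(ρ⁻¹ * δ), by positivity, ?_⟩
  have : a = ρ • b - δ • axis := by rw [h]; module
  rw [this, smul_sub, smul_smul, inv_mul_cancel₀ hρ.ne']; module

theorem SameSide.trans {a b c : E3} (h : SameSide a b) (h' : SameSide b c) : SameSide a c := by
  obtain ⟨ρ, δ, hρ, h⟩ := h
  obtain ⟨ρ', δ', hρ', h'⟩ := h'
  refine ⟨ρ * ρ', δ + ρ * δ', by positivity, ?_⟩
  rw [mul_smul, h', smul_add, h]; module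

theorem sameSide_add_axis (a : E3) (s : ℝ) : SameSide a (a + s • axis) :=
  ⟨1, s, one_pos, by simp⟩

theorem sameSide_smul (a : E3) {s : ℝ} (hs : 0 < s) : SameSide a (s • a) :=
  ⟨s⁻¹, 0, by positivity, by rw [smul_smul, inv_mul_cancel₀ hs.ne']; simp⟩

/-- Points of one half-plane are comparable. -/
theorem SameSide.trichotomy {a b : E3} (h : SameSide a b) :
    Above axis a b ∨ (∃ s : ℝ, 0 < s ∧ s • b = a) ∨ Above axis b a := by
  obtain ⟨ρ, δ, hρ, e⟩ := h
  rcases lt_trichotomy δ 0 with hδ | rfl | hδ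
  · right; right
    rw [← above_neg]
    exact ⟨ρ, -δ, hρ, by linarith, by rw [e]; module⟩
  · right; left
    exact ⟨ρ, hρ, by simpa using e⟩
  · left; exact ⟨ρ, δ, hρ, hδ, e⟩

theorem S2.eq_of_smul {x y : S2} {s : ℝ} (hs : 0 < s) (h : s • x.1 = y.1) : x = y := by
  have h1 : ‖s • x.1‖ = ‖y.1‖ := by rw [h]
  have hx : ‖x.1‖ = 1 := norm_eq_of_mem_sphere x
  have hy : ‖y.1‖ = 1 := norm_eq_of_mem_sphere y
  rw [norm_smul, hx, hy, mul_one, Real.norm_of_nonneg hs.le] at h1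
  subst h1
  exact Subtype.ext (by simpa using h)

theorem S2.ne_zero (x : S2) : x.1 ≠ 0 := by
  intro h
  have hx : ‖x.1‖ = 1 := norm_eq_of_mem_sphere x
  rw [h] at hx; simp at hx

theorem northPole_coe : (northPole : S2).1 = axis := rfl

theorem southPole_coe : (southPole : S2).1 = -axis := rfl

theorem eq_pole_of_not_offAxis {x : S2} (h : ¬ OffAxis x.1) : x = northPole ∨ x = southPole := by
  simp only [OffAxis, not_or, not_not] at h
  have e : x.1 = (x.1 2) • axis := by
    ext i
    fin_cases i <;> simp [h.1, h.2]
  have hx : ‖x.1‖ = 1 := norm_eq_of_mem_sphere x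
  rw [e, norm_smul] at hx
  simp only [axis, PiLp.norm_single, norm_one, mul_one, Real.norm_eq_abs] at hx
  rcases (abs_eq zero_le_one).1 hx with h2 | h2
  · left; apply Subtype.ext; rw [e, h2, northPole_coe]; simp
  · right; apply Subtype.ext; rw [e, h2, southPole_coe]; simp

theorem SameLongitude.exists_smul {x y : S2} (h : SameLongitude x y) : SameSide x.1 y.1 := by
  obtain ⟨φ, ⟨r, hr, h0, h1⟩, ⟨r', hr', h0', h1'⟩⟩ := h
  refine ⟨r / r', r / r' * y.1 2 - x.1 2, by positivity, smul_eq_add_axis_iff.2 ⟨?_, ?_, by ring⟩⟩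
  · rw [h0, h0']; field_simp
  · rw [h1, h1']; field_simp

theorem sameLongitude_of_sameSide {x y : S2} (hx : OffAxis x.1) (h : SameSide x.1 y.1) :
    SameLongitude x y := by
  obtain ⟨ρ, δ, hρ, e⟩ := h
  obtain ⟨h0, h1, -⟩ := smul_eq_add_axis_iff.1 e
  -- The horizontal part as a complex number; its argument is the angle of the longitude.
  set z : ℂ := ⟨x.1 0, x.1 1⟩ with hz
  have hz0 : z ≠ 0 := by
    intro h
    have a := congrArg Complex.re h
    have b := congrArg Complex.im h
    simp [hz] at a b
    rcases hx with hx | hx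
    exacts [hx a, hx b]
  have hc : x.1 0 = ‖z‖ * Real.cos z.arg := (Complex.norm_mul_cos_arg z).symm
  have hs : x.1 1 = ‖z‖ * Real.sin z.arg := (Complex.norm_mul_sin_arg z).symm
  have hn : 0 < ‖z‖ := norm_pos_iff.2 hz0
  refine ⟨z.arg, ⟨‖z‖, hn, hc, hs⟩, ρ⁻¹ * ‖z‖, by positivity, ?_, ?_⟩
  · rw [mul_assoc, ← hc, ← h0]; field_simp
  · rw [mul_assoc, ← hs, ← h1]; field_simp

/-! ## Radial projection -/

/-- The radial projection to the sphere. -/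
noncomputable def radial (v : E3) : S2 :=
  -- The value at `0` is a dummy; the arguments below project nonzero vectors.
  if h : v = 0 then northPole else ⟨‖v‖⁻¹ • v, by
    have := norm_ne_zero_iff.2 h
    simp [norm_smul, this]⟩

theorem radial_coe {v : E3} (h : v ≠ 0) : (radial v).1 = ‖v‖⁻¹ • v := by
  simp [radial, h]

theorem radial_self (x : S2) : radial x.1 = x := by
  have hx : ‖x.1‖ = 1 := norm_eq_of_mem_sphere x
  apply Subtype.ext
  rw [radial_coe x.ne_zero, hx]; simp

theorem exists_radial {v : E3} (h : v ≠ 0) : ∃ s : ℝ, 0 < s ∧ (radial v).1 = s • v :=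
  ⟨_, inv_pos.2 (norm_pos_iff.2 h), radial_coe h⟩

theorem radial_eq_of_smul {v : E3} {x : S2} {s : ℝ} (hs : 0 < s) (h : s • x.1 = v) :
    radial v = x := by
  have hv : v ≠ 0 := by rw [← h]; exact smul_ne_zero hs.ne' x.ne_zero
  obtain ⟨t, ht, e⟩ := exists_radial hv
  refine (S2.eq_of_smul (mul_pos ht hs) ?_).symm
  rw [e, ← h, smul_smul]

theorem continuous_radial {X : Type*} [TopologicalSpace X] {f : X → E3} (hf : Continuous f)
    (h0 : ∀ x, f x ≠ 0) : Continuous fun x => radial (f x) := by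
  rw [continuous_induced_rng]
  have : (Subtype.val ∘ fun x => radial (f x)) = fun x => ‖f x‖⁻¹ • f x := by
    funext x; exact radial_coe (h0 x)
  rw [this]
  exact (hf.norm.inv₀ fun x => norm_ne_zero_iff.2 (h0 x)).smul hf

/-- Connectedness on the sphere thereby reduces to convexity or star-shapedness in space. -/
theorem isPreconnected_radial_image {C : Set E3} (hC : IsPreconnected C) (h0 : (0 : E3) ∉ C) :
    IsPreconnected (radial '' C) := by
  refine hC.image _ ?_
  rw [continuousOn_iff_continuous_domRestrict]
  exact continuous_radial (f := fun x : C => x.1) continuous_subtype_val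
    fun x hx => h0 (hx ▸ x.2)

/-! ## Spherical triangles -/

/-- The open cone spanned by three vectors. -/
def openCone (a b c : E3) : Set E3 :=
  {x | ∃ s t u : ℝ, 0 < s ∧ 0 < t ∧ 0 < u ∧ x = s • a + t • b + u • c}

/-- The closed cone spanned by three vectors. -/
def closedCone (a b c : E3) : Set E3 :=
  {x | ∃ s t u : ℝ, 0 ≤ s ∧ 0 ≤ t ∧ 0 ≤ u ∧ x = s • a + t • b + u • c}

/-- The open small triangle with the given corners. -/
def openTri (a b c : S2) : Set S2 := {x | x.1 ∈ openCone a.1 b.1 c.1}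

/-- The closed small triangle with the given corners. -/
def closedTri (a b c : S2) : Set S2 := {x | x.1 ∈ closedCone a.1 b.1 c.1}

/-! ### Cones in space and their facet inequalities -/

section Cone

variable {a b c : E3}

theorem openCone_subset_closedCone : openCone a b c ⊆ closedCone a b c := by
  rintro x ⟨s, t, u, hs, ht, hu, rfl⟩
  exact ⟨s, t, u, hs.le, ht.le, hu.le, rfl⟩

theorem openCone_add_closedCone {x y : E3} (hx : x ∈ openCone a b c)
    (hy : y ∈ closedCone a b c) : x + y ∈ openCone a b c := by
  obtain ⟨s, t, u, hs, ht, hu, rfl⟩ := hx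
  obtain ⟨s', t', u', hs', ht', hu', rfl⟩ := hy
  exact ⟨s + s', t + t', u + u', by positivity, by positivity, by positivity, by module⟩

theorem closedCone_add {x y : E3} (hx : x ∈ closedCone a b c)
    (hy : y ∈ closedCone a b c) : x + y ∈ closedCone a b c := by
  obtain ⟨s, t, u, hs, ht, hu, rfl⟩ := hx
  obtain ⟨s', t', u', hs', ht', hu', rfl⟩ := hy
  exact ⟨s + s', t + t', u + u', by positivity, by positivity, by positivity, by module⟩

theorem smul_mem_openCone {x : E3} (hx : x ∈ openCone a b c) {r : ℝ} (hr : 0 < r) :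
    r • x ∈ openCone a b c := by
  obtain ⟨s, t, u, hs, ht, hu, rfl⟩ := hx
  exact ⟨r * s, r * t, r * u, by positivity, by positivity, by positivity, by module⟩

theorem smul_mem_closedCone {x : E3} (hx : x ∈ closedCone a b c) {r : ℝ} (hr : 0 ≤ r) :
    r • x ∈ closedCone a b c := by
  obtain ⟨s, t, u, hs, ht, hu, rfl⟩ := hx
  exact ⟨r * s, r * t, r * u, by positivity, by positivity, by positivity, by module⟩

theorem smul_mem_openCone_iff {x : E3} {r : ℝ} (hr : 0 < r) :
    r • x ∈ openCone a b c ↔ x ∈ openCone a b c := by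
  refine ⟨fun h => ?_, fun h => smul_mem_openCone h hr⟩
  have := smul_mem_openCone h (inv_pos.2 hr)
  rwa [smul_smul, inv_mul_cancel₀ hr.ne', one_smul] at this

theorem smul_mem_closedCone_iff {x : E3} {r : ℝ} (hr : 0 < r) :
    r • x ∈ closedCone a b c ↔ x ∈ closedCone a b c := by
  refine ⟨fun h => ?_, fun h => smul_mem_closedCone h hr.le⟩
  have := smul_mem_closedCone h (inv_pos.2 hr).le
  rwa [smul_smul, inv_mul_cancel₀ hr.ne', one_smul] at this

theorem orient_comb (s t u : ℝ) :
    orient (s • a + t • b + u • c) b c = s * orient a b c ∧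
    orient (s • a + t • b + u • c) c a = t * orient a b c ∧
    orient (s • a + t • b + u • c) a b = u * orient a b c := by
  simp only [orient_eq, PiLp.add_apply, PiLp.smul_apply, smul_eq_mul]
  refine ⟨?_, ?_, ?_⟩ <;> ring

/-- By Cramer's rule the coefficients of `x` are quotients of determinants. Multiplying by the
determinant of the corners, rather than dividing, treats both orientations at once. -/
theorem mem_openCone_iff (h : orient a b c ≠ 0) {x : E3} : x ∈ openCone a b c ↔
    0 < orient a b c * orient x b c ∧ 0 < orient a b c * orient x c a ∧
      0 < orient a b c * orient x a b := by
  have h2 : 0 < orient a b c * orient a b c := mul_self_pos.2 h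
  constructor
  · rintro ⟨s, t, u, hs, ht, hu, rfl⟩
    obtain ⟨e1, e2, e3⟩ := orient_comb (a := a) (b := b) (c := c) s t u
    rw [e1, e2, e3, mul_left_comm, mul_left_comm _ t, mul_left_comm _ u]
    exact ⟨by positivity, by positivity, by positivity⟩
  · rintro ⟨h1, h3, h4⟩
    refine ⟨_, _, _, div_pos h1 h2, div_pos h3 h2, div_pos h4 h2, ?_⟩
    simp only [mul_div_mul_left _ _ h]
    apply smul_right_injective E3 h
    simp only [smul_add, smul_smul, mul_div_cancel₀ _ h]
    exact orient_smul_eq a b c x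

theorem mem_closedCone_iff (h : orient a b c ≠ 0) {x : E3} : x ∈ closedCone a b c ↔
    0 ≤ orient a b c * orient x b c ∧ 0 ≤ orient a b c * orient x c a ∧
      0 ≤ orient a b c * orient x a b := by
  have h2 : 0 < orient a b c * orient a b c := mul_self_pos.2 h
  constructor
  · rintro ⟨s, t, u, hs, ht, hu, rfl⟩
    obtain ⟨e1, e2, e3⟩ := orient_comb (a := a) (b := b) (c := c) s t u
    rw [e1, e2, e3, mul_left_comm, mul_left_comm _ t, mul_left_comm _ u]
    exact ⟨by positivity, by positivity, by positivity⟩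
  · rintro ⟨h1, h3, h4⟩
    refine ⟨_, _, _, div_nonneg h1 h2.le, div_nonneg h3 h2.le, div_nonneg h4 h2.le, ?_⟩
    simp only [mul_div_mul_left _ _ h]
    apply smul_right_injective E3 h
    simp only [smul_add, smul_smul, mul_div_cancel₀ _ h]
    exact orient_smul_eq a b c x

theorem zero_notMem_openCone (h : orient a b c ≠ 0) : (0 : E3) ∉ openCone a b c := by
  rw [mem_openCone_iff h]
  simp [orient_eq]

theorem zero_mem_closedCone : (0 : E3) ∈ closedCone a b c :=
  ⟨0, 0, 0, le_rfl, le_rfl, le_rfl, by simp⟩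

theorem sum_mem_openCone : a + b + c ∈ openCone a b c :=
  ⟨1, 1, 1, one_pos, one_pos, one_pos, by simp⟩

theorem convex_openCone : Convex ℝ (openCone a b c) := by
  intro x hx y hy s t hs ht hst
  rcases hs.eq_or_lt with rfl | hs
  · have : t = 1 := by linarith
    simpa [this] using hy
  · exact openCone_add_closedCone (smul_mem_openCone hx hs)
      (smul_mem_closedCone (openCone_subset_closedCone hy) ht)

/-- The complement of a cone is star-shaped with respect to the opposite of the cone. -/
theorem sub_smul_sum_notMem {x : E3} (hx : x ∉ closedCone a b c) {s : ℝ} (hs : 0 ≤ s) :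
    x - s • (a + b + c) ∉ closedCone a b c := by
  intro h
  apply hx
  have := closedCone_add h
    (smul_mem_closedCone (openCone_subset_closedCone (sum_mem_openCone (a := a))) hs)
  simpa using this

theorem neg_sum_notMem (h : orient a b c ≠ 0) : -(a + b + c) ∉ closedCone a b c := by
  intro hc
  have := openCone_add_closedCone sum_mem_openCone hc
  rw [add_neg_cancel] at this
  exact zero_notMem_openCone h this

theorem notMem_of_sub_mem {x : E3} (hx : x ∉ openCone a b c) {s : ℝ}
    (hs : 0 < s) : x - s • (a + b + c) ∉ closedCone a b c := by
  intro hc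
  apply hx
  have := openCone_add_closedCone (smul_mem_openCone (sum_mem_openCone (a := a)) hs) hc
  simpa using this

end Cone

/-! ### Topology of a small triangle and of its complement -/

section Tri

variable {a b c : S2}

theorem openTri_subset_closedTri : openTri a b c ⊆ closedTri a b c :=
  fun _ hx => openCone_subset_closedCone hx

theorem isOpen_openTri (h : orient a.1 b.1 c.1 ≠ 0) : IsOpen (openTri a b c) := by
  have : openTri a b c = {x : S2 | 0 < orient a.1 b.1 c.1 * orient x.1 b.1 c.1} ∩
      {x : S2 | 0 < orient a.1 b.1 c.1 * orient x.1 c.1 a.1} ∩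
      {x : S2 | 0 < orient a.1 b.1 c.1 * orient x.1 a.1 b.1} := by
    ext x
    exact (mem_openCone_iff h).trans and_assoc.symm
  rw [this]
  refine ((isOpen_lt continuous_const ?_).inter (isOpen_lt continuous_const ?_)).inter
    (isOpen_lt continuous_const ?_) <;>
  exact continuous_const.mul
    (continuous_orient continuous_subtype_val continuous_const continuous_const)

theorem isClosed_closedTri (h : orient a.1 b.1 c.1 ≠ 0) : IsClosed (closedTri a b c) := by
  have : closedTri a b c = {x : S2 | 0 ≤ orient a.1 b.1 c.1 * orient x.1 b.1 c.1} ∩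
      {x : S2 | 0 ≤ orient a.1 b.1 c.1 * orient x.1 c.1 a.1} ∩
      {x : S2 | 0 ≤ orient a.1 b.1 c.1 * orient x.1 a.1 b.1} := by
    ext x
    exact (mem_closedCone_iff h).trans and_assoc.symm
  rw [this]
  refine ((isClosed_le continuous_const ?_).inter (isClosed_le continuous_const ?_)).inter
    (isClosed_le continuous_const ?_) <;>
  exact continuous_const.mul
    (continuous_orient continuous_subtype_val continuous_const continuous_const)

theorem isPreconnected_openTri (h : orient a.1 b.1 c.1 ≠ 0) : IsPreconnected (openTri a b c) := by
  have : openTri a b c = radial '' openCone a.1 b.1 c.1 := by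
    ext x
    constructor
    · exact fun hx => ⟨x.1, hx, radial_self x⟩
    · rintro ⟨v, hv, rfl⟩
      have hv0 : v ≠ 0 := fun e => zero_notMem_openCone h (e ▸ hv)
      obtain ⟨s, hs, e⟩ := exists_radial hv0
      show (radial v).1 ∈ openCone a.1 b.1 c.1
      rw [e]
      exact smul_mem_openCone hv hs
  rw [this]
  exact isPreconnected_radial_image convex_openCone.isPreconnected (zero_notMem_openCone h)

theorem isPreconnected_compl_closedTri (h : orient a.1 b.1 c.1 ≠ 0) :
    IsPreconnected (closedTri a b c)ᶜ := by
  have : (closedTri a b c)ᶜ = radial '' (closedCone a.1 b.1 c.1)ᶜ := by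
    ext x
    constructor
    · exact fun hx => ⟨x.1, hx, radial_self x⟩
    · rintro ⟨v, hv, rfl⟩
      have hv0 : v ≠ 0 := by
        rintro rfl
        exact hv zero_mem_closedCone
      obtain ⟨s, hs, e⟩ := exists_radial hv0
      show (radial v).1 ∉ closedCone a.1 b.1 c.1
      rw [e]
      exact fun hc => hv ((smul_mem_closedCone_iff hs).1 hc)
  rw [this]
  refine isPreconnected_radial_image ?_ fun hc => hc zero_mem_closedCone
  have hstar : StarConvex ℝ (-(a.1 + b.1 + c.1)) (closedCone a.1 b.1 c.1)ᶜ := by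
    intro x hx s t hs ht hst
    rcases ht.eq_or_lt with rfl | ht
    · have : s = 1 := by linarith
      subst this
      simpa using neg_sum_notMem h
    · have := sub_smul_sum_notMem (x := t • x) (s := s)
        (fun hc => hx ((smul_mem_closedCone_iff ht).1 hc)) hs
      rwa [show t • x - s • (a.1 + b.1 + c.1) = s • -(a.1 + b.1 + c.1) + t • x by module] at this
  exact (hstar.isPathConnected (by simpa using neg_sum_notMem h)).isConnected.isPreconnected

/-- As `ε` tends to `0` from above, the projection of `x + ε • v` tends to `x`. Closure questions on
the sphere thus become linear: push `x` in a suitable direction. -/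
theorem mem_closure_of_radial {S : Set S2} {x : S2} {v : E3}
    (h : ∀ ε : ℝ, 0 < ε → x.1 + ε • v ≠ 0 → radial (x.1 + ε • v) ∈ S) : x ∈ closure S := by
  have hc : Continuous fun ε : ℝ => x.1 + ε • v := by fun_prop
  have hne : ∀ᶠ ε : ℝ in 𝓝 0, x.1 + ε • v ≠ 0 :=
    hc.continuousAt.eventually_ne (by simp [x.ne_zero])
  have ht : Tendsto (fun ε : ℝ => radial (x.1 + ε • v)) (𝓝[>] 0) (𝓝 x) := by
    rw [tendsto_subtype_rng]
    have h1 : Tendsto (fun ε : ℝ => ‖x.1 + ε • v‖⁻¹ • (x.1 + ε • v)) (𝓝 0) (𝓝 x.1) := by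
      have h2 : ContinuousAt (fun ε : ℝ => ‖x.1 + ε • v‖⁻¹ • (x.1 + ε • v)) 0 :=
        (hc.norm.continuousAt.inv₀ (by simp)).smul hc.continuousAt
      have h3 := h2.tendsto
      simpa only [zero_smul, add_zero, norm_eq_of_mem_sphere x, inv_one, one_smul] using h3
    refine (h1.congr' ?_).mono_left nhdsWithin_le_nhds
    filter_upwards [hne] with ε hε
    rw [radial_coe hε]
  refine mem_closure_of_tendsto ht ?_
  filter_upwards [hne.filter_mono nhdsWithin_le_nhds, self_mem_nhdsWithin] with ε h1 h2
  exact h ε h2 h1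

theorem closure_openTri (h : orient a.1 b.1 c.1 ≠ 0) :
    closure (openTri a b c) = closedTri a b c := by
  refine subset_antisymm (closure_minimal openTri_subset_closedTri (isClosed_closedTri h)) ?_
  intro x hx
  refine mem_closure_of_radial (v := a.1 + b.1 + c.1) fun ε hε h0 => ?_
  obtain ⟨s, hs, e⟩ := exists_radial h0
  show (radial _).1 ∈ openCone a.1 b.1 c.1
  rw [e, add_comm]
  exact smul_mem_openCone (openCone_add_closedCone (smul_mem_openCone sum_mem_openCone hε) hx) hs

theorem interior_closedTri (h : orient a.1 b.1 c.1 ≠ 0) :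
    interior (closedTri a b c) = openTri a b c := by
  refine subset_antisymm ?_ (interior_maximal openTri_subset_closedTri (isOpen_openTri h))
  intro x hx
  by_contra hxo
  rw [← compl_compl (interior _), ← closure_compl] at hx
  refine hx (mem_closure_of_radial (v := -(a.1 + b.1 + c.1)) fun ε hε h0 => ?_)
  obtain ⟨s, hs, e⟩ := exists_radial h0
  show (radial _).1 ∉ closedCone a.1 b.1 c.1
  rw [e, smul_mem_closedCone_iff hs, smul_neg, ← sub_eq_add_neg]
  exact notMem_of_sub_mem hxo hε

theorem frontier_openTri (h : orient a.1 b.1 c.1 ≠ 0) :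
    frontier (openTri a b c) = closedTri a b c \ openTri a b c := by
  rw [frontier, closure_openTri h, (isOpen_openTri h).interior_eq]

theorem frontier_compl_closedTri (h : orient a.1 b.1 c.1 ≠ 0) :
    frontier (closedTri a b c)ᶜ = closedTri a b c \ openTri a b c := by
  rw [frontier_compl, frontier, (isClosed_closedTri h).closure_eq, interior_closedTri h]

theorem closedTri_diff_openTri (h : orient a.1 b.1 c.1 ≠ 0) :
    closedTri a b c \ openTri a b c = arc a b ∪ arc b c ∪ arc c a := by
  have h2 : 0 < orient a.1 b.1 c.1 * orient a.1 b.1 c.1 := mul_self_pos.2 h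
  ext x
  constructor
  · rintro ⟨⟨s, t, u, hs, ht, hu, e⟩, hx⟩
    rcases hs.eq_or_lt with rfl | hs'
    · exact Or.inl (Or.inr ⟨t, u, ht, hu, by simp [e]⟩)
    rcases ht.eq_or_lt with rfl | ht'
    · exact Or.inr ⟨u, s, hu, hs, by simp [e, add_comm]⟩
    rcases hu.eq_or_lt with rfl | hu'
    · exact Or.inl (Or.inl ⟨s, t, hs, ht, by simp [e]⟩)
    exact (hx ⟨s, t, u, hs', ht', hu', e⟩).elim
  · rintro ((⟨s, t, hs, ht, e⟩ | ⟨s, t, hs, ht, e⟩) | ⟨s, t, hs, ht, e⟩)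
    · refine ⟨⟨s, t, 0, hs, ht, le_rfl, by simp [e]⟩, fun hx => ?_⟩
      have := ((mem_openCone_iff h).1 hx).2.2
      simp [e, orient_add_left, orient_smul_left] at this
    · refine ⟨⟨0, s, t, le_rfl, hs, ht, by simp [e]⟩, fun hx => ?_⟩
      have := ((mem_openCone_iff h).1 hx).1
      simp [e, orient_add_left, orient_smul_left] at this
    · refine ⟨⟨t, 0, s, ht, le_rfl, hs, by simp [e, add_comm]⟩, fun hx => ?_⟩
      have := ((mem_openCone_iff h).1 hx).2.1
      simp [e, orient_add_left, orient_smul_left] at this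

theorem _root_.IsPreconnected.exists_mem_frontier {X : Type*} [TopologicalSpace X] {U V : Set X}
    (hV : IsPreconnected V) (h1 : (V ∩ U).Nonempty) (h2 : (V ∩ Uᶜ).Nonempty) :
    ∃ x ∈ V, x ∈ frontier U := by
  by_contra! hc
  obtain ⟨x, hxV, hxU⟩ := h1
  obtain ⟨y, hyV, hyU⟩ := h2
  have hsub : V ⊆ interior U ∪ (closure U)ᶜ := fun z hz => by
    by_contra hz'
    simp only [mem_union, mem_compl_iff, not_or, not_not] at hz'
    exact hc z hz ⟨hz'.2, hz'.1⟩
  obtain ⟨z, -, hz, hz'⟩ := hV _ _ isOpen_interior isClosed_closure.isOpen_compl hsub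
    ⟨x, hxV, (hsub hxV).resolve_right fun h => h (subset_closure hxU)⟩
    ⟨y, hyV, (hsub hyV).resolve_left fun h => hyU (interior_subset h)⟩
  exact hz' (subset_closure (interior_subset hz))

/-- A preconnected set that meets `U` but not its frontier lies in `U`. -/
theorem subset_of_disjoint_frontier {X : Type*} [TopologicalSpace X] {U V : Set X}
    (hV : IsPreconnected V) (hd : ∀ x ∈ V, x ∉ frontier U) {x : X} (hxV : x ∈ V) (hxU : x ∈ U) :
    V ⊆ U := by
  intro y hy
  by_contra hyU
  obtain ⟨z, hz, hz'⟩ := hV.exists_mem_frontier ⟨x, hxV, hxU⟩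
    ⟨y, hy, hyU⟩
  exact hd z hz hz'

/-- A connected set disjoint from its frontier that is bounded by a triangle is one of the two
sides of the triangle. -/
theorem eq_openTri_or_eq_compl (h : orient a.1 b.1 c.1 ≠ 0) {U : Set S2} (hU : IsPreconnected U)
    (hne : U.Nonempty) (hf : frontier U = closedTri a b c \ openTri a b c)
    (hd : ∀ x ∈ U, x ∉ frontier U) : U = openTri a b c ∨ U = (closedTri a b c)ᶜ := by
  have hsub : U ⊆ openTri a b c ∨ U ⊆ (closedTri a b c)ᶜ := by
    refine hU.subset_or_subset (isOpen_openTri h) (isClosed_closedTri h).isOpen_compl ?_ ?_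
    · exact disjoint_compl_right.mono_left openTri_subset_closedTri
    · intro x hx
      have := hd x hx
      rw [hf] at this
      by_cases hxo : x ∈ openTri a b c
      · exact Or.inl hxo
      · exact Or.inr fun hc => this ⟨hc, hxo⟩
  obtain ⟨x, hx⟩ := hne
  rcases hsub with hs | hs
  · left
    refine hs.antisymm (subset_of_disjoint_frontier (isPreconnected_openTri h) ?_ (hs hx) hx)
    rintro y hy hy'
    rw [hf] at hy'
    exact hy'.2 hy
  · right
    refine hs.antisymm
      (subset_of_disjoint_frontier (isPreconnected_compl_closedTri h) ?_ (hs hx) hx)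
    rintro y hy hy'
    rw [hf] at hy'
    exact hy hy'.1

/-- The longitude from `x` to the pole `P` is connected and leaves `S`, so it crosses the frontier
strictly between them. It is parametrised by projecting the segment from `x` to `P`, which misses
the origin because `x` is off the axis. -/
theorem exists_above_frontier {S : Set S2} {x P : S2} (hP : P = northPole ∨ P = southPole)
    (hx : OffAxis x.1) (hxS : x ∈ S) (hPS : P ∉ S) (hxf : x ∉ frontier S) (hPf : P ∉ frontier S) :
    ∃ z ∈ frontier S, Above P.1 x.1 z.1 := by
  have hne : ∀ s ∈ Icc (0 : ℝ) 1, (1 - s) • x.1 + s • P.1 ≠ 0 := by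
    rintro s ⟨hs0, hs1⟩
    rcases hs1.eq_or_lt with rfl | hs1
    · simpa using P.ne_zero
    · rcases hP with rfl | rfl
      · exact ((hx.smul (by linarith : (1 - s) ≠ 0)).add_axis s).ne_zero
      · have := ((hx.smul (by linarith : (1 - s) ≠ 0)).add_axis (-s)).ne_zero
        rwa [southPole_coe, smul_neg, ← neg_smul]
  have hc : Continuous fun s : ℝ => (1 - s) • x.1 + s • P.1 := by fun_prop
  have hpre : IsPreconnected (radial '' ((fun s : ℝ => (1 - s) • x.1 + s • P.1) '' Icc 0 1)) := by
    refine isPreconnected_radial_image (isPreconnected_Icc.image _ hc.continuousOn) ?_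
    rintro ⟨s, hs, e⟩
    exact hne s hs e
  obtain ⟨z, ⟨-, ⟨s, hs, rfl⟩, e⟩, hz⟩ := hpre.exists_mem_frontier
    ⟨x, ⟨x.1, ⟨0, by simp, by simp⟩, radial_self x⟩, hxS⟩
    ⟨P, ⟨P.1, ⟨1, by simp, by simp⟩, radial_self P⟩, hPS⟩
  refine ⟨z, hz, ?_⟩
  have hs0 : s ≠ 0 := by
    rintro rfl
    apply hxf
    rwa [← radial_self x, show x.1 = (1 - (0 : ℝ)) • x.1 + (0 : ℝ) • P.1 by simp, e]
  have hs1 : s ≠ 1 := by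
    rintro rfl
    apply hPf
    rwa [← radial_self P, show P.1 = (1 - (1 : ℝ)) • x.1 + (1 : ℝ) • P.1 by simp, e]
  have hs0 : 0 < s := lt_of_le_of_ne hs.1 hs0.symm
  have hs1 : 0 < 1 - s := sub_pos.2 (lt_of_le_of_ne hs.2 hs1)
  obtain ⟨r, hr, e'⟩ := exists_radial (hne s hs)
  refine ⟨(r * (1 - s))⁻¹, s / (1 - s), by positivity, by positivity, ?_⟩
  have e'' : z.1 = r • ((1 - s) • x.1 + s • P.1) := by rw [← e', ← e]
  rw [e'', smul_smul, smul_add, smul_smul, smul_smul]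
  congr 2
  · rw [show (r * (1 - s))⁻¹ * r * (1 - s) = (r * (1 - s))⁻¹ * (r * (1 - s)) by ring,
      inv_mul_cancel₀ (by positivity)]; simp
  · field_simp

end Tri

variable {n : ℕ}
variable {G : SimpleGraph (Fin n)}

/-! ## Edges of the realization -/

theorem vertex_mem_edge_left (u v : Fin n) : vertex G u ∈ edge G u v := by
  intro x hx
  by_contra h
  exact hx (Pi.single_eq_of_ne (fun e => h (Or.inl e)) 1)

theorem edge_comm (u v : Fin n) : edge G u v = edge G v u := by
  ext w; exact forall_congr' fun x => imp_congr_right fun _ => or_comm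

theorem vertex_mem_edge_right (u v : Fin n) : vertex G v ∈ edge G u v := by
  rw [edge_comm]; exact vertex_mem_edge_left v u

theorem eq_vertex_of_mem_edge_self {v : Fin n} {w : Realization G} (h : w ∈ edge G v v) :
    w = vertex G v := by
  have h0 : ∀ x, x ≠ v → w.1 x = 0 := fun x hx => by
    by_contra hc
    exact hx (by simpa using h x hc)
  have h1 := w.2.1.2
  rw [Finset.sum_eq_single v (fun x _ hx => h0 x hx) (by simp)] at h1
  apply Subtype.ext
  funext x
  by_cases hx : x = v
  · subst hx; simp [vertex, h1]
  · simp [vertex, h0 x hx, hx]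

theorem mem_edge_self_of_eq_zero {u v : Fin n} {w : Realization G} (h : w ∈ edge G u v)
    (hu : w.1 u = 0) : w = vertex G v := by
  refine eq_vertex_of_mem_edge_self fun x hx => ?_
  rcases h x hx with rfl | rfl
  · exact absurd hu hx
  · exact Or.inl rfl

theorem vertex_apply_self (v : Fin n) : (vertex G v).1 v = 1 := by simp [vertex]

theorem vertex_mem_edge_iff {u v x : Fin n} : vertex G x ∈ edge G u v ↔ x = u ∨ x = v := by
  constructor
  · intro h; exact h x (by simp [vertex_apply_self])
  · rintro (rfl | rfl)
    exacts [vertex_mem_edge_left _ _, vertex_mem_edge_right _ _]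

theorem isClosed_edge (u v : Fin n) : IsClosed (edge G u v) := by
  have : edge G u v = ⋂ x : Fin n, {w : Realization G | w.1 x ≠ 0 → x = u ∨ x = v} := by
    ext w; simp [edge]
  rw [this]
  refine isClosed_iInter fun x => ?_
  by_cases hx : x = u ∨ x = v
  · simp [hx]
  · simp only [hx, imp_false, not_not]
    exact isClosed_eq ((continuous_apply x).comp continuous_subtype_val) continuous_const

theorem Realization.exists_edge (w : Realization G) :
    ∃ u v : Fin n, (u = v ∨ G.Adj u v) ∧ w ∈ edge G u v := w.2.2

variable {Γ : Realization G → S2}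

/-! ## Edge coordinates -/

/-- `c` writes the point `Γ w` as a combination of the corners of the edge of `w`. -/
def IsCoef (Γ : Realization G → S2) (w : Realization G) (c : Fin n → ℝ) : Prop :=
  (∀ v, 0 ≤ c v) ∧ (∀ v, w.1 v = 0 → c v = 0) ∧ (Γ w).1 = ∑ v, c v • (pos Γ v).1

theorem IsShortestPathDrawing.exists_isCoef (h : IsShortestPathDrawing Γ) (w : Realization G) :
    ∃ c, IsCoef Γ w c := by
  have hv : ∀ v, w = vertex G v → ∃ c, IsCoef Γ w c := by
    rintro v rfl
    refine ⟨Pi.single v 1, fun x => ?_, fun x hx => hx, ?_⟩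
    · by_cases hx : x = v
      · subst hx; simp
      · simp [hx]
    · rw [Finset.sum_eq_single v (fun x _ hx => by simp [hx]) (by simp)]
      simp [pos]
  obtain ⟨u, v, huv, hw⟩ := w.exists_edge
  rcases huv with rfl | huv
  · exact hv _ (eq_vertex_of_mem_edge_self hw)
  by_cases hu : w.1 u = 0
  · exact hv v (mem_edge_self_of_eq_zero hw hu)
  by_cases hv' : w.1 v = 0
  · exact hv u (mem_edge_self_of_eq_zero (by rwa [edge_comm]) hv')
  have hmem := mem_image_of_mem Γ hw
  rw [h.edge_eq_arc u v huv] at hmem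
  obtain ⟨s, t, hs, ht, e⟩ := hmem
  have hne : u ≠ v := huv.ne
  refine ⟨fun x => if x = u then s else if x = v then t else 0, fun x => ?_, fun x hx => ?_, ?_⟩
  · dsimp only; split_ifs <;> first | assumption | exact le_rfl
  · have h1 : x ≠ u := by rintro rfl; exact hu hx
    have h2 : x ≠ v := by rintro rfl; exact hv' hx
    simp [h1, h2]
  · rw [Finset.sum_eq_add u v hne (fun x _ hx => by simp [hx.1, hx.2]) (by simp) (by simp), e]
    simp [hne.symm]

/-- Coefficients of `Γ w` with respect to the vertices. -/
noncomputable def coef (Γ : Realization G → S2) (w : Realization G) : Fin n → ℝ :=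
  -- The choice operator keeps the definition total; its value is meaningful once `Γ` is a
  -- shortest-path drawing.
  Classical.epsilon (IsCoef Γ w)

theorem IsShortestPathDrawing.isCoef (h : IsShortestPathDrawing Γ) (w : Realization G) :
    IsCoef Γ w (coef Γ w) := Classical.epsilon_spec (h.exists_isCoef w)

theorem IsShortestPathDrawing.coef_eq_zero (h : IsShortestPathDrawing Γ) {w : Realization G}
    {u v x : Fin n} (hw : w ∈ edge G u v) (hu : x ≠ u) (hv : x ≠ v) : coef Γ w x = 0 := by
  refine (h.isCoef w).2.1 x ?_
  by_contra hc
  rcases hw x hc with e | e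
  exacts [hu e, hv e]

theorem IsShortestPathDrawing.sum_coef (h : IsShortestPathDrawing Γ) {w : Realization G}
    {u v : Fin n} (huv : u ≠ v) (hw : w ∈ edge G u v) (f : Fin n → E3) :
    ∑ x, coef Γ w x • f x = coef Γ w u • f u + coef Γ w v • f v :=
  Finset.sum_eq_add u v huv (fun x _ hx => by rw [h.coef_eq_zero hw hx.1 hx.2, zero_smul])
    (by simp) (by simp)

/-- The vertex `v` shifted by `k v` along the axis. -/
noncomputable def shift (Γ : Realization G → S2) (k : Fin n → ℝ) (v : Fin n) : E3 :=
  (pos Γ v).1 + k v • axis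

/-- The amount by which `w` is shifted when every vertex `v` is shifted by `k v`. -/
noncomputable def rise (Γ : Realization G → S2) (k : Fin n → ℝ) (w : Realization G) : ℝ :=
  ∑ v, coef Γ w v * k v

/-- The point `Γ w` shifted along the axis, linearly along each edge. -/
noncomputable def lift (Γ : Realization G → S2) (k : Fin n → ℝ) (w : Realization G) : E3 :=
  (Γ w).1 + rise Γ k w • axis

/-- The lifted edge is spanned by the lifted endpoints with the same coefficients, which is why
shifting turns great-circular arcs into great-circular arcs. -/
theorem IsShortestPathDrawing.lift_eq_sum (h : IsShortestPathDrawing Γ) (k : Fin n → ℝ)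
    (w : Realization G) : lift Γ k w = ∑ v, coef Γ w v • shift Γ k v := by
  simp only [lift, shift, rise, smul_add, Finset.sum_add_distrib, Finset.sum_smul, mul_smul]
  rw [← (h.isCoef w).2.2]

theorem IsShortestPathDrawing.coef_vertex (h : IsShortestPathDrawing Γ) (v : Fin n) :
    coef Γ (vertex G v) v = 1 ∧ ∀ x, x ≠ v → coef Γ (vertex G v) x = 0 := by
  have h0 : ∀ x, x ≠ v → coef Γ (vertex G v) x = 0 := fun x hx =>
    h.coef_eq_zero (vertex_mem_edge_left v v) hx hx
  refine ⟨?_, h0⟩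
  have e := (h.isCoef (vertex G v)).2.2
  rw [Finset.sum_eq_single v (fun x _ hx => by rw [h0 x hx, zero_smul]) (by simp)] at e
  have hn := congrArg norm e
  have hp : ‖(pos Γ v).1‖ = 1 := norm_eq_of_mem_sphere _
  rw [norm_smul, hp, Real.norm_of_nonneg ((h.isCoef _).1 v), mul_one] at hn
  rw [← hn]
  exact hp

theorem IsShortestPathDrawing.lift_vertex (h : IsShortestPathDrawing Γ) (k : Fin n → ℝ)
    (v : Fin n) : lift Γ k (vertex G v) = shift Γ k v := by
  obtain ⟨h1, h0⟩ := h.coef_vertex v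
  rw [h.lift_eq_sum, Finset.sum_eq_single v (fun x _ hx => by rw [h0 x hx, zero_smul]) (by simp),
    h1, one_smul]

theorem orient_axis_shift (k : Fin n → ℝ) (u v : Fin n) :
    orient axis (shift Γ k u) (shift Γ k v) = orient axis (pos Γ u).1 (pos Γ v).1 := by
  simp [shift, orient_axis]

/-! ## Triangulations and longitudes -/

namespace IsTriangulation

theorem orient_axis_ne (h : IsTriangulation Γ) {u v : Fin n} (huv : u ≠ v) :
    orient axis (pos Γ u).1 (pos Γ v).1 ≠ 0 := h.generic_poles u v huv

theorem toDrawing (h : IsTriangulation Γ) : IsShortestPathDrawing Γ :=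
  h.toIsShortestPathEmbedding.toIsShortestPathDrawing

theorem offAxis_pos (h : IsTriangulation Γ) (hn : 4 ≤ n) (v : Fin n) : OffAxis (pos Γ v).1 := by
  have : Nontrivial (Fin n) := Fin.nontrivial_iff_two_le.2 (by omega)
  obtain ⟨u, hu⟩ := exists_ne v
  exact offAxis_of_orient (h.orient_axis_ne hu.symm)

/-- Pairing with the axis and one endpoint isolates the coefficient of the other. No great circle
through the poles contains two vertices, so the denominator is nonzero and the formula is continuous
in `w`. -/
theorem coef_eq (h : IsTriangulation Γ) {u v : Fin n} (huv : u ≠ v) {w : Realization G}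
    (hw : w ∈ edge G u v) : coef Γ w u =
      orient axis (Γ w).1 (pos Γ v).1 / orient axis (pos Γ u).1 (pos Γ v).1 := by
  rw [eq_div_iff (h.orient_axis_ne huv), (h.toDrawing.isCoef w).2.2,
    h.toDrawing.sum_coef huv hw (fun v => (pos Γ v).1), orient_add_mid, orient_smul_mid,
    orient_smul_mid]
  simp

theorem continuous_coef (h : IsTriangulation Γ) (x : Fin n) :
    Continuous fun w => coef Γ w x := by
  -- A finite closed cover of the realization on which continuity can be glued; the diagonal pairs
  -- take care of single vertices.
  let ι := {p : Fin n × Fin n // p.1 = p.2 ∨ G.Adj p.1 p.2}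
  refine (locallyFinite_of_finite fun p : ι => edge G p.1.1 p.1.2).continuous ?_
    (fun p => isClosed_edge _ _) ?_
  · rw [eq_univ_iff_forall]
    intro w
    obtain ⟨u, v, huv, hw⟩ := w.exists_edge
    exact mem_iUnion.2 ⟨⟨(u, v), huv⟩, hw⟩
  · rintro ⟨⟨u, v⟩, huv⟩
    dsimp only at huv ⊢
    have key : ∀ u v, u ≠ v → ContinuousOn (fun w => coef Γ w u) (edge G u v) := by
      intro u v hne
      refine ContinuousOn.congr (Continuous.continuousOn ?_) fun w hw => h.coef_eq hne hw
      exact (continuous_orient continuous_const (continuous_subtype_val.comp h.continuous)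
        continuous_const).div_const _
    rcases huv with rfl | huv
    · refine Set.Subsingleton.continuousOn (fun w hw w' hw' => ?_) _
      rw [eq_vertex_of_mem_edge_self hw, eq_vertex_of_mem_edge_self hw']
    by_cases hu : x = u
    · subst hu; exact key _ _ huv.ne
    by_cases hv : x = v
    · subst hv; rw [edge_comm]; exact key _ _ huv.ne'
    exact continuousOn_const.congr fun w hw => h.toDrawing.coef_eq_zero hw hu hv

theorem continuous_rise (h : IsTriangulation Γ) (k : Fin n → ℝ) : Continuous (rise Γ k) :=
  continuous_finsetSum _ fun v _ => (h.continuous_coef v).mul continuous_const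

/-- On the axis both edge coefficients would vanish by `coef_eq`. -/
theorem offAxis (h : IsTriangulation Γ) (hn : 4 ≤ n) (w : Realization G) : OffAxis (Γ w).1 := by
  obtain ⟨u, v, huv, hw⟩ := w.exists_edge
  rcases huv with rfl | huv
  · rw [eq_vertex_of_mem_edge_self hw]; exact h.offAxis_pos hn u
  by_contra hc
  have e1 := h.coef_eq huv.ne hw
  have e2 := h.coef_eq huv.ne' (by rwa [edge_comm])
  simp only [OffAxis, not_or, not_not] at hc
  simp only [orient_axis, hc.1, hc.2, zero_mul, sub_zero, zero_div] at e1 e2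
  have e := (h.toDrawing.isCoef w).2.2
  rw [h.toDrawing.sum_coef huv.ne hw (fun v => (pos Γ v).1), e1, e2] at e
  exact (Γ w).ne_zero (by simpa using e)

theorem northPole_notMem (h : IsTriangulation Γ) (hn : 4 ≤ n) : northPole ∉ range Γ := by
  rintro ⟨w, hw⟩
  have := h.offAxis hn w
  rw [hw, northPole_coe] at this
  simp [OffAxis] at this

theorem southPole_notMem (h : IsTriangulation Γ) (hn : 4 ≤ n) : southPole ∉ range Γ := by
  rintro ⟨w, hw⟩
  have := h.offAxis hn w
  rw [hw, southPole_coe] at this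
  simp [OffAxis] at this

theorem eq_of_smul (h : IsTriangulation Γ) {w w' : Realization G} {s : ℝ} (hs : 0 < s)
    (e : s • (Γ w).1 = (Γ w').1) : w = w' :=
  h.injective (S2.eq_of_smul hs e)

/-- The plane of an edge does not contain the axis, so a longitude crosses the edge at most once. -/
theorem eq_of_mem_edge_of_sameSide (h : IsTriangulation Γ) {u v : Fin n} (huv : u ≠ v)
    {w w' : Realization G} (hw : w ∈ edge G u v) (hw' : w' ∈ edge G u v)
    (hs : SameSide (Γ w).1 (Γ w').1) : w = w' := by
  obtain ⟨ρ, δ, hρ, e⟩ := hs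
  have h1 := (h.toDrawing.isCoef w).2.2
  have h2 := (h.toDrawing.isCoef w').2.2
  rw [h.toDrawing.sum_coef huv hw (fun v => (pos Γ v).1)] at h1
  rw [h.toDrawing.sum_coef huv hw' (fun v => (pos Γ v).1)] at h2
  have h3 : orient (Γ w).1 (pos Γ u).1 (pos Γ v).1 = 0 := by
    rw [h1]; simp [orient_add_left, orient_smul_left]
  have h4 : orient (Γ w').1 (pos Γ u).1 (pos Γ v).1 = 0 := by
    rw [h2]; simp [orient_add_left, orient_smul_left]
  have h5 := congrArg (fun x => orient x (pos Γ u).1 (pos Γ v).1) e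
  simp only [orient_smul_left, orient_add_left, h3, h4, mul_zero, zero_add] at h5
  have hδ : δ = 0 := by simpa [h.orient_axis_ne huv] using h5.symm
  subst hδ
  exact (h.eq_of_smul hρ (by simpa using e)).symm

/-- A longitude contains only finitely many points of the drawing. -/
theorem finite_sameSide (h : IsTriangulation Γ) (a : E3) :
    {w | SameSide a (Γ w).1}.Finite := by
  choose u v huv hw using fun w : Realization G => w.exists_edge
  -- Choosing an edge through each point is injective on a longitude, and there are finitely many
  -- edges.
  refine Set.Finite.of_finite_image (f := fun w => (u w, v w)) (toFinite _) ?_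
  intro w hs w' hs' e
  obtain ⟨e1, e2⟩ := Prod.ext_iff.1 e
  dsimp only at e1 e2
  have hw1 := hw w
  have hw2 := hw w'
  rw [← e1, ← e2] at hw2
  rcases huv w with e | e
  · rw [← e] at hw1 hw2
    rw [eq_vertex_of_mem_edge_self hw1, eq_vertex_of_mem_edge_self hw2]
  · exact h.eq_of_mem_edge_of_sameSide e.ne hw1 hw2 ((SameSide.symm hs).trans hs')

/-- A transitive relation that holds between consecutive points of each longitude holds between
any two points of a longitude. -/
theorem above_induction (h : IsTriangulation Γ) (hn : 4 ≤ n) {R : Realization G → Realization G → Prop}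
    (hc : ∀ w w', Above axis (Γ w).1 (Γ w').1 →
      (∀ x, Above axis (Γ w).1 (Γ x).1 → ¬ Above axis (Γ x).1 (Γ w').1) → R w w')
    (ht : ∀ w x w', Above axis (Γ w).1 (Γ x).1 → Above axis (Γ x).1 (Γ w').1 →
      R w x → R x w' → R w w')
    {w w' : Realization G} (hw : Above axis (Γ w).1 (Γ w').1) : R w w' := by
  -- The points strictly between; strong induction on their number, splitting at any one of them.
  let B := fun w w' => {x | Above axis (Γ w).1 (Γ x).1 ∧ Above axis (Γ x).1 (Γ w').1}
  have hfin : ∀ w w', (B w w').Finite := fun w w' =>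
    (h.finite_sameSide (Γ w).1).subset fun x hx => hx.1.sameSide
  have key : ∀ (m : ℕ) (w w' : Realization G), Above axis (Γ w).1 (Γ w').1 →
      (B w w').ncard = m → R w w' := by
    intro m
    induction m using Nat.strong_induction_on with
    | _ m ih =>
      intro w w' hw hm
      by_cases hx : ∃ x, Above axis (Γ w).1 (Γ x).1 ∧ Above axis (Γ x).1 (Γ w').1
      · obtain ⟨x, hx1, hx2⟩ := hx
        have hx3 : ¬ Above axis (Γ x).1 (Γ x).1 := not_above_self (h.offAxis hn x)
        refine ht w x w' hx1 hx2 (ih _ ?_ w x hx1 rfl) (ih _ ?_ x w' hx2 rfl)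
        · rw [← hm]
          refine ncard_lt_ncard ⟨fun y hy => ⟨hy.1, hy.2.trans hx2⟩, fun hs => ?_⟩ (hfin _ _)
          exact hx3 (hs (show x ∈ B w w' from ⟨hx1, hx2⟩)).2
        · rw [← hm]
          refine ncard_lt_ncard ⟨fun y hy => ⟨hx1.trans hy.1, hy.2⟩, fun hs => ?_⟩ (hfin _ _)
          exact hx3 (hs (show x ∈ B w w' from ⟨hx1, hx2⟩)).1
      · push Not at hx
        exact hc w w' hw hx
  exact key _ w w' hw rfl

end IsTriangulation

/-! ## Faces of a triangulation -/

/-- The cycle through the vertices `i`, `j`, `l` in the realization. -/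
def cycle3 (G : SimpleGraph (Fin n)) (i j l : Fin n) : Set (Realization G) :=
  edge G i j ∪ edge G j l ∪ edge G l i

theorem IsFace.subset {U : Set S2} (h : IsFace Γ U) : U ⊆ (range Γ)ᶜ := by
  obtain ⟨x, -, rfl⟩ := h
  exact connectedComponentIn_subset _ _

theorem IsFace.isPreconnected {U : Set S2} (h : IsFace Γ U) : IsPreconnected U := by
  obtain ⟨x, -, rfl⟩ := h
  exact isPreconnected_connectedComponentIn

theorem IsFace.nonempty {U : Set S2} (h : IsFace Γ U) : U.Nonempty := by
  obtain ⟨x, hx, rfl⟩ := h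
  exact ⟨x, mem_connectedComponentIn hx⟩

/-- A preconnected set that avoids the drawing and whose frontier lies in the drawing is a face. -/
theorem isFace_of_frontier_subset {V : Set S2} (hV : IsPreconnected V) (hne : V.Nonempty)
    (hd : V ⊆ (range Γ)ᶜ) (hf : frontier V ⊆ range Γ) : IsFace Γ V := by
  obtain ⟨x, hx⟩ := hne
  refine ⟨x, hd hx, (hV.subset_connectedComponentIn hx hd).antisymm ?_⟩
  exact subset_of_disjoint_frontier isPreconnected_connectedComponentIn
    (fun y hy hy' => connectedComponentIn_subset _ _ hy (hf hy'))
    (mem_connectedComponentIn (hd hx)) hx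

theorem BoundedBy.frontier_eq {U : Set S2} {i j l : Fin n} (h : BoundedBy Γ U i j l) :
    frontier U = Γ '' cycle3 G i j l := by
  rw [h.2.2.2, cycle3, image_union, image_union]

theorem image_cycle3 (h : IsShortestPathDrawing Γ) {i j l : Fin n} (hij : G.Adj i j)
    (hjl : G.Adj j l) (hli : G.Adj l i)
    (ho : orient (pos Γ i).1 (pos Γ j).1 (pos Γ l).1 ≠ 0) : Γ '' cycle3 G i j l =
      closedTri (pos Γ i) (pos Γ j) (pos Γ l) \ openTri (pos Γ i) (pos Γ j) (pos Γ l) := by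
  rw [cycle3, image_union, image_union, closedTri_diff_openTri ho, h.edge_eq_arc _ _ hij,
    h.edge_eq_arc _ _ hjl, h.edge_eq_arc _ _ hli]

/-- On a cycle of three edges the coordinates are supported on its vertices. -/
theorem sum_coef_of_mem_cycle3 (h : IsShortestPathDrawing Γ) {i j l : Fin n} (hij : i ≠ j)
    (hjl : j ≠ l) (hli : l ≠ i) {w : Realization G} (hw : w ∈ cycle3 G i j l) (f : Fin n → E3) :
    ∑ x, coef Γ w x • f x = coef Γ w i • f i + coef Γ w j • f j + coef Γ w l • f l := by
  have h0 : ∀ {u v x : Fin n}, w ∈ edge G u v → x ≠ u → x ≠ v → coef Γ w x • f x = 0 :=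
    fun hw hu hv => by rw [h.coef_eq_zero hw hu hv, zero_smul]
  rcases hw with (hw | hw) | hw
  · rw [h.sum_coef hij hw, h0 hw hli hjl.symm, add_zero]
  · rw [h.sum_coef hjl hw, h0 hw hij hli.symm, zero_add]
  · rw [h.sum_coef hli hw, h0 hw hjl hij.symm, add_zero, add_comm]

theorem vertex_mem_cycle3_iff {i j l x : Fin n} :
    vertex G x ∈ cycle3 G i j l ↔ x = i ∨ x = j ∨ x = l := by
  simp only [cycle3, mem_union, vertex_mem_edge_iff]
  tauto

namespace IsTriangulation

theorem orient_ne (h : IsTriangulation Γ) {U : Set S2} {i j l : Fin n}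
    (hb : BoundedBy Γ U i j l) : orient (pos Γ i).1 (pos Γ j).1 (pos Γ l).1 ≠ 0 :=
  h.generic i j l hb.1.ne hb.2.1.ne hb.2.2.1.ne'

theorem frontier_eq (h : IsTriangulation Γ) {U : Set S2} {i j l : Fin n}
    (hb : BoundedBy Γ U i j l) : frontier U =
      closedTri (pos Γ i) (pos Γ j) (pos Γ l) \ openTri (pos Γ i) (pos Γ j) (pos Γ l) := by
  rw [hb.frontier_eq, image_cycle3 h.toDrawing hb.1 hb.2.1 hb.2.2.1 (h.orient_ne hb)]

theorem face_eq (h : IsTriangulation Γ) {U : Set S2} {i j l : Fin n} (hU : IsFace Γ U)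
    (hb : BoundedBy Γ U i j l) : U = openTri (pos Γ i) (pos Γ j) (pos Γ l) ∨
      U = (closedTri (pos Γ i) (pos Γ j) (pos Γ l))ᶜ := by
  refine eq_openTri_or_eq_compl (h.orient_ne hb) hU.isPreconnected hU.nonempty (h.frontier_eq hb) ?_
  intro x hx hxf
  rw [hb.frontier_eq] at hxf
  exact hU.subset hx (image_subset_range _ _ hxf)

/-- A polar point of the closed triangle lies in the open triangle. -/
theorem pole_mem_openTri (h : IsTriangulation Γ) (hn : 4 ≤ n) {U : Set S2} {i j l : Fin n}
    (hb : BoundedBy Γ U i j l) {P : S2} (hP : P = northPole ∨ P = southPole)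
    (hm : P ∈ closedTri (pos Γ i) (pos Γ j) (pos Γ l)) :
    P ∈ openTri (pos Γ i) (pos Γ j) (pos Γ l) := by
  by_contra hc
  have : P ∈ frontier U := by rw [h.frontier_eq hb]; exact ⟨hm, hc⟩
  rw [hb.frontier_eq] at this
  have := image_subset_range _ _ this
  rcases hP with rfl | rfl
  exacts [h.northPole_notMem hn this, h.southPole_notMem hn this]

/-- Antipodal points would sum to `0`, which is not in the open cone. -/
theorem not_both_poles_mem {a b c : S2} (ho : orient a.1 b.1 c.1 ≠ 0)
    (hN : northPole ∈ openTri a b c) (hS : southPole ∈ closedTri a b c) : False := by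
  have := openCone_add_closedCone (show (northPole : S2).1 ∈ _ from hN)
    (show (southPole : S2).1 ∈ _ from hS)
  rw [northPole_coe, southPole_coe, add_neg_cancel] at this
  exact zero_notMem_openCone ho this

/-- A face without poles is the small triangle with its corners. -/
theorem face_eq_of_isNonPolar (h : IsTriangulation Γ) (hn : 4 ≤ n) {U : Set S2} {i j l : Fin n}
    (hU : IsFace Γ U) (hb : BoundedBy Γ U i j l) (hp : IsNonPolar U) :
    U = openTri (pos Γ i) (pos Γ j) (pos Γ l) ∧
      northPole ∉ closedTri (pos Γ i) (pos Γ j) (pos Γ l) ∧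
      southPole ∉ closedTri (pos Γ i) (pos Γ j) (pos Γ l) := by
  rcases h.face_eq hU hb with e | e
  · refine ⟨e, fun hc => hp.1 ?_, fun hc => hp.2 ?_⟩
    · rw [e]; exact h.pole_mem_openTri hn hb (Or.inl rfl) hc
    · rw [e]; exact h.pole_mem_openTri hn hb (Or.inr rfl) hc
  · exfalso
    obtain ⟨hN, hS⟩ := hp
    rw [e, mem_compl_iff, not_not] at hN hS
    exact not_both_poles_mem (h.orient_ne hb) (h.pole_mem_openTri hn hb (Or.inl rfl) hN) hS

/-- Consecutive points on a longitude lie on a common non-polar face. -/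
theorem exists_face_of_consecutive (h : IsTriangulation Γ) (hn : 4 ≤ n) {w w' : Realization G}
    (hw : Above axis (Γ w).1 (Γ w').1)
    (hc : ∀ x, Above axis (Γ w).1 (Γ x).1 → ¬ Above axis (Γ x).1 (Γ w').1) :
    ∃ U i j l, IsFace Γ U ∧ BoundedBy Γ U i j l ∧ IsNonPolar U ∧
      w ∈ cycle3 G i j l ∧ w' ∈ cycle3 G i j l := by
  obtain ⟨ρ, δ, hρ, hδ, e⟩ := hw
  let f : ℝ → S2 := fun s => radial ((Γ w).1 + s • axis)
  have h0 : ∀ s : ℝ, (Γ w).1 + s • axis ≠ 0 := fun s => ((h.offAxis hn w).add_axis s).ne_zero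
  have hf : Continuous f := continuous_radial (by fun_prop) h0
  -- The open piece of longitude misses the drawing, since a hit would lie strictly between; hence
  -- it lies in one face, with both ends on the boundary.
  have hAd : f '' Ioo 0 δ ⊆ (range Γ)ᶜ := by
    rintro _ ⟨s, hs, rfl⟩ ⟨x, hx⟩
    obtain ⟨r, hr, e'⟩ := exists_radial (h0 s)
    have e'' : (Γ x).1 = r • ((Γ w).1 + s • axis) := by rw [← e', hx]
    have e3 : (Γ w).1 + s • axis = r⁻¹ • (Γ x).1 := by
      rw [e'', smul_smul, inv_mul_cancel₀ hr.ne', one_smul]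
    refine hc x ⟨r⁻¹, s, by positivity, hs.1, e3.symm⟩ ?_
    refine ⟨r * ρ, r * (δ - s), by positivity, mul_pos hr (sub_pos.2 hs.2), ?_⟩
    rw [mul_smul, e, e'']; module
  have hm : δ / 2 ∈ Ioo 0 δ := ⟨by linarith, by linarith⟩
  have hx0 := hAd (mem_image_of_mem f hm)
  obtain ⟨U, hUdef⟩ : ∃ U, U = connectedComponentIn (range Γ)ᶜ (f (δ / 2)) := ⟨_, rfl⟩
  have hUF : IsFace Γ U := ⟨_, hx0, hUdef⟩
  have hAU : f '' Ioo 0 δ ⊆ U := by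
    rw [hUdef]
    exact (isPreconnected_Ioo.image _ hf.continuousOn).subset_connectedComponentIn
      (mem_image_of_mem f hm) hAd
  have hcl : ∀ s ∈ Icc 0 δ, f s ∈ closure U := fun s hs => by
    refine closure_mono hAU (image_closure_subset_closure_image hf (mem_image_of_mem f ?_))
    rwa [closure_Ioo hδ.ne]
  have hfw : f 0 = Γ w := by
    show radial _ = _
    rw [zero_smul, add_zero, radial_self]
  have hfw' : f δ = Γ w' := radial_eq_of_smul hρ e
  obtain ⟨i, j, l, hb⟩ := h.faces U hUF
  have hfr : ∀ x, Γ x ∈ closure U → Γ x ∈ frontier U := fun x hx =>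
    ⟨hx, fun hi => hUF.subset (interior_subset hi) (mem_range_self x)⟩
  have hwf : Γ w ∈ frontier U := hfr w (hfw ▸ hcl 0 ⟨le_rfl, hδ.le⟩)
  have hwf' : Γ w' ∈ frontier U := hfr w' (hfw' ▸ hcl δ ⟨hδ.le, le_rfl⟩)
  have hcyc : ∀ x, Γ x ∈ frontier U → x ∈ cycle3 G i j l := fun x hx => by
    rw [hb.frontier_eq] at hx
    exact h.injective.mem_set_image.1 hx
  refine ⟨U, i, j, l, hUF, hb, ?_, hcyc w hwf, hcyc w' hwf'⟩
  rw [h.frontier_eq hb] at hwf hwf'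
  -- The complement is excluded because the middle of the piece is a nonnegative combination of two
  -- boundary points, hence in the closed triangle.
  have hUt : U = openTri (pos Γ i) (pos Γ j) (pos Γ l) := by
    refine (h.face_eq hUF hb).resolve_right fun hU => ?_
    have : f (δ / 2) ∈ U := hAU (mem_image_of_mem f hm)
    rw [hU] at this
    apply this
    obtain ⟨r, hr, e'⟩ := exists_radial (h0 (δ / 2))
    show (radial _).1 ∈ closedCone _ _ _
    rw [e', smul_mem_closedCone_iff hr, show (Γ w).1 + (δ / 2) • axis =
      (1 / 2 : ℝ) • (Γ w).1 + (1 / 2 : ℝ) • ρ • (Γ w').1 by rw [e]; module]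
    exact closedCone_add (smul_mem_closedCone hwf.1 (by norm_num))
      (smul_mem_closedCone (smul_mem_closedCone hwf'.1 hρ.le) (by norm_num))
  -- A pole in the open triangle would pull one end off the boundary: `w'` is `w` plus a positive
  -- multiple of the north direction, and `w` is `w'` plus one of the south.
  constructor
  · intro hN
    rw [hUt] at hN
    have hN : axis ∈ openCone _ _ _ := hN
    refine hwf'.2 ((smul_mem_openCone_iff hρ).1 ?_)
    rw [e, add_comm]
    exact openCone_add_closedCone (smul_mem_openCone hN hδ) hwf.1
  · intro hS
    rw [hUt] at hS
    have hS : -axis ∈ openCone _ _ _ := hS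
    apply hwf.2
    show (Γ w).1 ∈ openCone _ _ _
    rw [show (Γ w).1 = δ • -axis + ρ • (Γ w').1 by rw [e]; module]
    exact openCone_add_closedCone (smul_mem_openCone hS hδ) (smul_mem_closedCone hwf'.1 hρ.le)

end IsTriangulation

/-! ## Shifts that preserve the orientation of non-polar faces -/

/-- The shift by `k` preserves the orientations of all non-polar faces. -/
def IsAdmissible (Γ : Realization G → S2) (k : Fin n → ℝ) : Prop :=
  ∀ U i j l, IsFace Γ U → BoundedBy Γ U i j l → IsNonPolar U →
    0 < orient (pos Γ i).1 (pos Γ j).1 (pos Γ l).1 *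
      orient (shift Γ k i) (shift Γ k j) (shift Γ k l)

namespace IsTriangulation

variable {k : Fin n → ℝ}

/-- The difference `ρ • Γ w' - Γ w = δ • axis` has coordinates `di`, `dj`, `dl` in the corners,
given by Cramer's rule. After the shift it is still vertical, of length `δ + di * k i + dj * k j +
dl * k l`, which is `δ` times the quotient of the shifted determinant by the old one. Admissibility
makes it positive. -/
theorem above_lift_of_consecutive (h : IsTriangulation Γ) (hk : IsAdmissible Γ k) {U : Set S2}
    {i j l : Fin n} (hU : IsFace Γ U) (hb : BoundedBy Γ U i j l) (hp : IsNonPolar U)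
    {w w' : Realization G} (hw : w ∈ cycle3 G i j l) (hw' : w' ∈ cycle3 G i j l)
    (ha : Above axis (Γ w).1 (Γ w').1) : Above axis (lift Γ k w) (lift Γ k w') := by
  obtain ⟨ρ, δ, hρ, hδ, e⟩ := ha
  have hkU := hk U i j l hU hb hp
  have hD := h.orient_ne hb
  have hs := fun {x} hx => sum_coef_of_mem_cycle3 h.toDrawing (w := x) hb.1.ne hb.2.1.ne
    hb.2.2.1.ne hx
  have e1 := (h.toDrawing.isCoef w).2.2
  have e2 := (h.toDrawing.isCoef w').2.2
  rw [hs hw fun v => (pos Γ v).1] at e1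
  rw [hs hw' fun v => (pos Γ v).1] at e2
  have l1 := h.toDrawing.lift_eq_sum k w
  have l2 := h.toDrawing.lift_eq_sum k w'
  rw [hs hw] at l1
  rw [hs hw'] at l2
  set D := orient (pos Γ i).1 (pos Γ j).1 (pos Γ l).1
  set di := ρ * coef Γ w' i - coef Γ w i with hdi
  set dj := ρ * coef Γ w' j - coef Γ w j with hdj
  set dl := ρ * coef Γ w' l - coef Γ w l with hdl
  have hax : δ • axis = di • (pos Γ i).1 + dj • (pos Γ j).1 + dl • (pos Γ l).1 := by
    have : δ • axis = ρ • (Γ w').1 - (Γ w).1 := by rw [e]; module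
    rw [this, e1, e2, hdi, hdj, hdl]; module
  obtain ⟨o1, o2, o3⟩ := orient_comb (a := (pos Γ i).1) (b := (pos Γ j).1) (c := (pos Γ l).1)
    di dj dl
  rw [← hax, orient_smul_left] at o1 o2 o3
  have hl : ρ • lift Γ k w' = lift Γ k w + (δ + (di * k i + dj * k j + dl * k l)) • axis := by
    rw [l1, l2, add_smul, hax, hdi, hdj, hdl]
    simp only [shift]
    module
  refine ⟨ρ, _, hρ, ?_, hl⟩
  simp only [shift] at hkU
  rw [orient_add_axis] at hkU
  -- The quotient identity with denominators cleared by the square of `D`.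
  have key : D * D * (δ + (di * k i + dj * k j + dl * k l)) = δ * (D * (D +
      (k i * orient axis (pos Γ j).1 (pos Γ l).1 + k j * orient axis (pos Γ l).1 (pos Γ i).1 +
        k l * orient axis (pos Γ i).1 (pos Γ j).1))) := by
    linear_combination -D * k i * o1 - D * k j * o2 - D * k l * o3
  have : 0 < D * D * (δ + (di * k i + dj * k j + dl * k l)) := by
    rw [key]; exact mul_pos hδ hkU
  exact pos_of_mul_pos_right this (mul_self_nonneg D)

/-- An admissible shift preserves the order of the points on each longitude. -/
theorem above_lift (h : IsTriangulation Γ) (hn : 4 ≤ n) (hk : IsAdmissible Γ k)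
    {w w' : Realization G} (ha : Above axis (Γ w).1 (Γ w').1) :
    Above axis (lift Γ k w) (lift Γ k w') := by
  refine h.above_induction hn (R := fun w w' => Above axis (lift Γ k w) (lift Γ k w')) ?_
    (fun w x w' _ _ h1 h2 => h1.trans h2) ha
  intro w w' ha hc
  obtain ⟨U, i, j, l, hU, hb, hp, hw, hw'⟩ := h.exists_face_of_consecutive hn ha hc
  exact h.above_lift_of_consecutive hk hU hb hp hw hw' ha

theorem sameSide_lift (k : Fin n → ℝ) (w : Realization G) : SameSide (Γ w).1 (lift Γ k w) :=
  sameSide_add_axis _ _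

theorem offAxis_lift (h : IsTriangulation Γ) (hn : 4 ≤ n) (k : Fin n → ℝ) (w : Realization G) :
    OffAxis (lift Γ k w) := (h.offAxis hn w).add_axis _

theorem trichotomy (h : IsTriangulation Γ) {w w' : Realization G}
    (hs : SameSide (Γ w).1 (Γ w').1) :
    Above axis (Γ w).1 (Γ w').1 ∨ w = w' ∨ Above axis (Γ w').1 (Γ w).1 := by
  rcases hs.trichotomy with h1 | ⟨s, hs, e⟩ | h1
  · exact Or.inl h1
  · exact Or.inr (Or.inl (h.eq_of_smul hs e).symm)
  · exact Or.inr (Or.inr h1)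

theorem above_lift_iff (h : IsTriangulation Γ) (hn : 4 ≤ n) (hk : IsAdmissible Γ k)
    {w w' : Realization G} :
    Above axis (lift Γ k w) (lift Γ k w') ↔ Above axis (Γ w).1 (Γ w').1 := by
  refine ⟨fun ha => ?_, h.above_lift hn hk⟩
  have hs : SameSide (Γ w).1 (Γ w').1 :=
    ((sameSide_lift k w).trans ha.sameSide).trans (sameSide_lift k w').symm
  rcases h.trichotomy hs with h1 | rfl | h1
  · exact h1
  · exact (not_above_self (h.offAxis_lift hn k w) ha).elim
  · exact (not_above_self (h.offAxis_lift hn k w) (ha.trans (h.above_lift hn hk h1))).elim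

theorem eq_of_lift_eq_smul (h : IsTriangulation Γ) (hn : 4 ≤ n) (hk : IsAdmissible Γ k)
    {w w' : Realization G} {s : ℝ} (hs : 0 < s) (e : lift Γ k w' = s • lift Γ k w) : w = w' := by
  have hss : SameSide (Γ w).1 (Γ w').1 := by
    refine (sameSide_lift k w).trans (SameSide.trans ?_ (sameSide_lift k w').symm)
    rw [e]; exact sameSide_smul _ hs
  have hno : ∀ t : ℝ, 0 < t → ¬ Above axis (lift Γ k w) (t • lift Γ k w) := fun t ht ha => by
    refine not_above_self (h.offAxis_lift hn k w) ?_
    have := ha.smul one_pos (inv_pos.2 ht)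
    rwa [one_smul, smul_smul, inv_mul_cancel₀ ht.ne', one_smul] at this
  rcases h.trichotomy hss with h1 | h1 | h1
  · have := h.above_lift hn hk h1
    rw [e] at this
    exact (hno s hs this).elim
  · exact h1
  · have := h.above_lift hn hk h1
    have := this.smul (inv_pos.2 hs) (inv_pos.2 hs)
    rw [e, smul_smul, inv_mul_cancel₀ hs.ne', one_smul] at this
    exact (hno _ (inv_pos.2 hs) this).elim

end IsTriangulation

/-! ## The shifted drawing -/

/-- The drawing obtained from `Γ` by moving every vertex `v` along its longitude according to the
shift `k v`. -/
noncomputable def shiftDrawing (Γ : Realization G → S2) (k : Fin n → ℝ) (w : Realization G) : S2 :=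
  radial (lift Γ k w)

theorem rise_smul (k : Fin n → ℝ) (t : ℝ) (w : Realization G) :
    rise Γ (t • k) w = t * rise Γ k w := by
  simp only [rise, Pi.smul_apply, smul_eq_mul, Finset.mul_sum]
  exact Finset.sum_congr rfl fun v _ => by ring

theorem shiftDrawing_zero : shiftDrawing Γ 0 = Γ := by
  funext w
  simp [shiftDrawing, lift, rise, radial_self]

namespace IsTriangulation

variable {k : Fin n → ℝ}

theorem exists_shiftDrawing (h : IsTriangulation Γ) (hn : 4 ≤ n) (k : Fin n → ℝ)
    (w : Realization G) : ∃ r : ℝ, 0 < r ∧ (shiftDrawing Γ k w).1 = r • lift Γ k w :=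
  exists_radial (h.offAxis_lift hn k w).ne_zero

theorem exists_pos_shiftDrawing (h : IsTriangulation Γ) (hn : 4 ≤ n) (k : Fin n → ℝ)
    (v : Fin n) : ∃ r : ℝ, 0 < r ∧ (pos (shiftDrawing Γ k) v).1 = r • shift Γ k v := by
  rw [← h.toDrawing.lift_vertex]
  exact h.exists_shiftDrawing hn k _

theorem exists_orient_pos (h : IsTriangulation Γ) (hn : 4 ≤ n) (k : Fin n → ℝ)
    (i j l : Fin n) : ∃ r : ℝ, 0 < r ∧ orient (pos (shiftDrawing Γ k) i).1
      (pos (shiftDrawing Γ k) j).1 (pos (shiftDrawing Γ k) l).1 =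
      r * orient (shift Γ k i) (shift Γ k j) (shift Γ k l) := by
  obtain ⟨a, ha, ea⟩ := h.exists_pos_shiftDrawing hn k i
  obtain ⟨b, hb, eb⟩ := h.exists_pos_shiftDrawing hn k j
  obtain ⟨c, hc, ec⟩ := h.exists_pos_shiftDrawing hn k l
  refine ⟨a * b * c, by positivity, ?_⟩
  rw [ea, eb, ec, orient_smul_left, orient_smul_mid, orient_smul_right]; ring

theorem exists_orient_axis_pos (h : IsTriangulation Γ) (hn : 4 ≤ n) (k : Fin n → ℝ)
    (i j : Fin n) : ∃ r : ℝ, 0 < r ∧ orient axis (pos (shiftDrawing Γ k) i).1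
      (pos (shiftDrawing Γ k) j).1 = r * orient axis (pos Γ i).1 (pos Γ j).1 := by
  obtain ⟨a, ha, ea⟩ := h.exists_pos_shiftDrawing hn k i
  obtain ⟨b, hb, eb⟩ := h.exists_pos_shiftDrawing hn k j
  refine ⟨a * b, by positivity, ?_⟩
  rw [ea, eb, orient_smul_mid, orient_smul_right, orient_axis_shift]; ring

theorem orient_axis_shiftDrawing_ne (h : IsTriangulation Γ) (hn : 4 ≤ n) (k : Fin n → ℝ)
    {i j : Fin n} (hij : i ≠ j) : orient axis (pos (shiftDrawing Γ k) i).1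
      (pos (shiftDrawing Γ k) j).1 ≠ 0 := by
  obtain ⟨r, hr, e⟩ := h.exists_orient_axis_pos hn k i j
  rw [e]
  exact mul_ne_zero hr.ne' (h.orient_axis_ne hij)

theorem sameSide_shiftDrawing (h : IsTriangulation Γ) (hn : 4 ≤ n) (k : Fin n → ℝ)
    (w : Realization G) : SameSide (Γ w).1 (shiftDrawing Γ k w).1 := by
  obtain ⟨r, hr, e⟩ := h.exists_shiftDrawing hn k w
  rw [e]
  exact (sameSide_lift k w).trans (sameSide_smul _ hr)

theorem sameLongitude_shiftDrawing (h : IsTriangulation Γ) (hn : 4 ≤ n) (k : Fin n → ℝ)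
    (w : Realization G) : SameLongitude (Γ w) (shiftDrawing Γ k w) :=
  sameLongitude_of_sameSide (h.offAxis hn w) (h.sameSide_shiftDrawing hn k w)

theorem offAxis_shiftDrawing (h : IsTriangulation Γ) (hn : 4 ≤ n) (k : Fin n → ℝ)
    (w : Realization G) : OffAxis (shiftDrawing Γ k w).1 := by
  obtain ⟨r, hr, e⟩ := h.exists_shiftDrawing hn k w
  rw [e]
  exact (h.offAxis_lift hn k w).smul hr.ne'

theorem pole_notMem_range_shiftDrawing (h : IsTriangulation Γ) (hn : 4 ≤ n) (k : Fin n → ℝ)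
    {P : S2} (hP : P = northPole ∨ P = southPole) : P ∉ range (shiftDrawing Γ k) := by
  rintro ⟨w, hw⟩
  have := h.offAxis_shiftDrawing hn k w
  rw [hw] at this
  rcases hP with rfl | rfl
  · rw [northPole_coe] at this; simp [OffAxis] at this
  · rw [southPole_coe] at this; simp [OffAxis] at this

/-- All shifts up to `k` together form a continuous family of drawings. -/
theorem continuous_shiftDrawing_smul (h : IsTriangulation Γ) (hn : 4 ≤ n) (k : Fin n → ℝ) :
    Continuous fun p : unitInterval × Realization G => shiftDrawing Γ ((p.1 : ℝ) • k) p.2 := by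
  refine continuous_radial ?_ fun p => (h.offAxis_lift hn _ p.2).ne_zero
  simp only [lift, rise_smul]
  have := h.continuous_rise k
  have h1 : Continuous fun p : unitInterval × Realization G => (Γ p.2).1 :=
    continuous_subtype_val.comp (h.continuous.comp continuous_snd)
  have h2 : Continuous fun p : unitInterval × Realization G => (p.1 : ℝ) * rise Γ k p.2 :=
    (continuous_subtype_val.comp continuous_fst).mul (this.comp continuous_snd)
  exact h1.add (h2.smul continuous_const)

theorem injective_shiftDrawing (h : IsTriangulation Γ) (hn : 4 ≤ n) (hk : IsAdmissible Γ k) :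
    Function.Injective (shiftDrawing Γ k) := by
  intro w w' e
  obtain ⟨r, hr, e1⟩ := h.exists_shiftDrawing hn k w
  obtain ⟨r', hr', e2⟩ := h.exists_shiftDrawing hn k w'
  refine h.eq_of_lift_eq_smul hn hk (s := r'⁻¹ * r) (by positivity) ?_
  rw [mul_smul, ← e1, e, e2, smul_smul, inv_mul_cancel₀ hr'.ne', one_smul]

theorem image_edge_shiftDrawing (h : IsTriangulation Γ) (hn : 4 ≤ n) (k : Fin n → ℝ)
    {u v : Fin n} (huv : G.Adj u v) : shiftDrawing Γ k '' edge G u v =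
      arc (pos (shiftDrawing Γ k) u) (pos (shiftDrawing Γ k) v) := by
  obtain ⟨a, ha, ea⟩ := h.exists_pos_shiftDrawing hn k u
  obtain ⟨b, hb, eb⟩ := h.exists_pos_shiftDrawing hn k v
  ext x
  constructor
  · rintro ⟨w, hw, rfl⟩
    obtain ⟨r, hr, e⟩ := h.exists_shiftDrawing hn k w
    have hc := (h.toDrawing.isCoef w).1
    refine ⟨r * coef Γ w u * a⁻¹, r * coef Γ w v * b⁻¹,
      mul_nonneg (mul_nonneg hr.le (hc u)) (inv_nonneg.2 ha.le),
      mul_nonneg (mul_nonneg hr.le (hc v)) (inv_nonneg.2 hb.le), ?_⟩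
    rw [e, h.toDrawing.lift_eq_sum, h.toDrawing.sum_coef huv.ne hw, ea, eb, smul_smul, smul_smul,
      mul_assoc, mul_assoc _ b⁻¹, inv_mul_cancel₀ ha.ne', inv_mul_cancel₀ hb.ne']
    module
  · rintro ⟨s, t, hs, ht, e⟩
    rw [ea, eb] at e
    -- Undo the shift: the same coefficients on the original endpoints give the preimage, up to
    -- scale.
    set y : E3 := (s * a) • (pos Γ u).1 + (t * b) • (pos Γ v).1 with hy
    have hsa : 0 ≤ s * a := mul_nonneg hs ha.le
    have htb : 0 ≤ t * b := mul_nonneg ht hb.le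
    have hy0 : y ≠ 0 := by
      intro h0
      have h1 := congrArg (fun z => orient axis z (pos Γ v).1) h0
      have h2 := congrArg (fun z => orient axis z (pos Γ u).1) h0
      rw [hy] at h1 h2
      simp only [orient_add_mid, orient_smul_mid, orient_self_right, mul_zero, add_zero,
        zero_add] at h1 h2
      rw [show orient axis 0 (pos Γ v).1 = 0 by simp [orient_axis]] at h1
      rw [show orient axis 0 (pos Γ u).1 = 0 by simp [orient_axis]] at h2
      have h3 := (mul_eq_zero.1 h1).resolve_right (h.orient_axis_ne huv.ne)
      have h4 := (mul_eq_zero.1 h2).resolve_right (h.orient_axis_ne huv.ne')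
      rw [smul_smul, smul_smul, h3, h4] at e
      exact x.ne_zero (by simpa using e)
    obtain ⟨r, hr, er⟩ := exists_radial hy0
    have hmem : radial y ∈ Γ '' edge G u v := by
      rw [h.edge_eq_arc u v huv]
      refine ⟨r * (s * a), r * (t * b), by positivity, by positivity, ?_⟩
      rw [er, hy]; module
    obtain ⟨w, hw, ew⟩ := hmem
    refine ⟨w, hw, radial_eq_of_smul hr ?_⟩
    have c1 : coef Γ w u = r * (s * a) := by
      rw [h.coef_eq huv.ne hw, div_eq_iff (h.orient_axis_ne huv.ne), ew, er, hy]
      simp [orient_add_mid, orient_smul_mid]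
      ring
    have c2 : coef Γ w v = r * (t * b) := by
      rw [h.coef_eq huv.ne' (by rwa [edge_comm]), div_eq_iff (h.orient_axis_ne huv.ne'), ew, er, hy]
      simp [orient_add_mid, orient_smul_mid]
      ring
    rw [e, h.toDrawing.lift_eq_sum, h.toDrawing.sum_coef huv.ne hw, c1, c2]
    module

theorem embedding_shiftDrawing (h : IsTriangulation Γ) (hn : 4 ≤ n) (hk : IsAdmissible Γ k) :
    IsShortestPathEmbedding (shiftDrawing Γ k) where
  continuous := by
    have := (h.continuous_shiftDrawing_smul hn k).comp
      (Continuous.prodMk_right (1 : unitInterval))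
    simpa [Function.comp_def] using this
  not_antipodal u v huv e := by
    apply h.orient_axis_shiftDrawing_ne hn k huv.ne
    rw [e]
    simp [orient_axis]; ring
  simple_edge u v _ := (h.injective_shiftDrawing hn hk).injOn
  edge_eq_arc u v huv := h.image_edge_shiftDrawing hn k huv
  injective := h.injective_shiftDrawing hn hk

theorem above_shiftDrawing_iff (h : IsTriangulation Γ) (hn : 4 ≤ n) (hk : IsAdmissible Γ k)
    {P : S2} (hP : P = northPole ∨ P = southPole) {w w' : Realization G} :
    Above P.1 (shiftDrawing Γ k w).1 (shiftDrawing Γ k w').1 ↔ Above P.1 (Γ w).1 (Γ w').1 := by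
  have key : ∀ {w w' : Realization G},
      Above axis (shiftDrawing Γ k w).1 (shiftDrawing Γ k w').1 ↔ Above axis (Γ w).1 (Γ w').1 := by
    intro w w'
    rw [← h.above_lift_iff hn hk]
    obtain ⟨r, hr, e1⟩ := h.exists_shiftDrawing hn k w
    obtain ⟨r', hr', e2⟩ := h.exists_shiftDrawing hn k w'
    rw [e1, e2]
    refine ⟨fun ha => ?_, fun ha => ha.smul hr hr'⟩
    have := ha.smul (inv_pos.2 hr) (inv_pos.2 hr')
    rwa [smul_smul, smul_smul, inv_mul_cancel₀ hr.ne', inv_mul_cancel₀ hr'.ne', one_smul,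
      one_smul] at this
  rcases hP with rfl | rfl
  · exact key
  · rw [southPole_coe, above_neg, above_neg]; exact key

end IsTriangulation

/-! ### Faces of the shifted drawing -/

theorem mem_closedCone_of_between {P a b c x y z : E3} (h1 : Above P x y) (h2 : Above P z x)
    (hy : y ∈ closedCone a b c) (hz : z ∈ closedCone a b c) : x ∈ closedCone a b c := by
  obtain ⟨ρ, δ, hρ, hδ, e⟩ := h1
  obtain ⟨ρ', δ', hρ', hδ', e'⟩ := h2
  have hpos : 0 < δ' + δ * ρ' := by positivity
  refine (smul_mem_closedCone_iff hpos).1 ?_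
  have : (δ' + δ * ρ') • x = (δ' * ρ) • y + δ • z := by
    rw [mul_smul, e, add_smul, mul_smul, e']; module
  rw [this]
  exact closedCone_add (smul_mem_closedCone hy (by positivity)) (smul_mem_closedCone hz hδ.le)

/-- The facet inequalities at the two poles differ by a sign, as do those of the two orientations.
The resulting criterion sees only longitudes, so a shift cannot change whether the small triangle
contains some pole, though it may change which one. -/
theorem pole_mem_closedTri_iff {a b c : S2} (ho : orient a.1 b.1 c.1 ≠ 0) :
    (northPole ∈ closedTri a b c ∨ southPole ∈ closedTri a b c) ↔
      (0 ≤ orient axis b.1 c.1 ∧ 0 ≤ orient axis c.1 a.1 ∧ 0 ≤ orient axis a.1 b.1) ∨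
      (orient axis b.1 c.1 ≤ 0 ∧ orient axis c.1 a.1 ≤ 0 ∧ orient axis a.1 b.1 ≤ 0) := by
  have hneg : ∀ x y : E3, orient (-axis) x y = -orient axis x y := fun x y => by
    rw [← neg_one_smul ℝ axis, orient_smul_left]; ring
  have hN : northPole ∈ closedTri a b c ↔ _ := mem_closedCone_iff ho (x := axis)
  have hS : southPole ∈ closedTri a b c ↔ _ := mem_closedCone_iff ho (x := -axis)
  rw [hN, hS]
  simp only [hneg]
  rcases lt_or_gt_of_ne ho with hD | hD
  · have hm : ∀ y, 0 ≤ orient a.1 b.1 c.1 * y ↔ y ≤ 0 := fun y =>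
      ⟨fun hy => by by_contra! hc; exact hy.not_gt (mul_neg_of_neg_of_pos hD hc),
        fun hy => mul_nonneg_of_nonpos_of_nonpos hD.le hy⟩
    simp only [hm, neg_nonpos]
    exact or_comm
  · simp only [mul_nonneg_iff_of_pos_left hD]
    simp only [Left.nonneg_neg_iff]

namespace IsTriangulation

variable {k : Fin n → ℝ}

theorem pole_mem_closedTri_shiftDrawing_iff (h : IsTriangulation Γ) (hn : 4 ≤ n) {i j l : Fin n}
    (ho : orient (pos Γ i).1 (pos Γ j).1 (pos Γ l).1 ≠ 0)
    (ho' : orient (pos (shiftDrawing Γ k) i).1 (pos (shiftDrawing Γ k) j).1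
      (pos (shiftDrawing Γ k) l).1 ≠ 0) :
    (northPole ∈ closedTri (pos (shiftDrawing Γ k) i) (pos (shiftDrawing Γ k) j)
        (pos (shiftDrawing Γ k) l) ∨
      southPole ∈ closedTri (pos (shiftDrawing Γ k) i) (pos (shiftDrawing Γ k) j)
        (pos (shiftDrawing Γ k) l)) ↔
    (northPole ∈ closedTri (pos Γ i) (pos Γ j) (pos Γ l) ∨
      southPole ∈ closedTri (pos Γ i) (pos Γ j) (pos Γ l)) := by
  rw [pole_mem_closedTri_iff ho, pole_mem_closedTri_iff ho']
  obtain ⟨r1, h1, e1⟩ := h.exists_orient_axis_pos hn k j l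
  obtain ⟨r2, h2, e2⟩ := h.exists_orient_axis_pos hn k l i
  obtain ⟨r3, h3, e3⟩ := h.exists_orient_axis_pos hn k i j
  rw [e1, e2, e3]
  have hm : ∀ {r y : ℝ}, 0 < r → (r * y ≤ 0 ↔ y ≤ 0) := fun hr =>
    ⟨fun hy => by by_contra! hc; exact hy.not_gt (mul_pos hr hc),
      fun hy => mul_nonpos_of_nonneg_of_nonpos hr.le hy⟩
  simp only [mul_nonneg_iff_of_pos_left h1, mul_nonneg_iff_of_pos_left h2,
    mul_nonneg_iff_of_pos_left h3, hm h1, hm h2, hm h3]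

theorem image_cycle3_shiftDrawing (h : IsTriangulation Γ) (hn : 4 ≤ n) (hk : IsAdmissible Γ k)
    {U : Set S2} {i j l : Fin n} (hb : BoundedBy Γ U i j l)
    (ho' : orient (pos (shiftDrawing Γ k) i).1 (pos (shiftDrawing Γ k) j).1
      (pos (shiftDrawing Γ k) l).1 ≠ 0) :
    shiftDrawing Γ k '' cycle3 G i j l =
      closedTri (pos (shiftDrawing Γ k) i) (pos (shiftDrawing Γ k) j)
          (pos (shiftDrawing Γ k) l) \
        openTri (pos (shiftDrawing Γ k) i) (pos (shiftDrawing Γ k) j)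
          (pos (shiftDrawing Γ k) l) :=
  image_cycle3 (h.embedding_shiftDrawing hn hk).toIsShortestPathDrawing hb.1 hb.2.1 hb.2.2.1 ho'

theorem face_of_frontier {U V : Set S2} {i j l : Fin n} (hb : BoundedBy Γ U i j l) (hV : IsPreconnected V)
    (hne : V.Nonempty) (hd : V ⊆ (range (shiftDrawing Γ k))ᶜ)
    (hf : frontier V = shiftDrawing Γ k '' cycle3 G i j l) :
    IsFace (shiftDrawing Γ k) V ∧ BoundedBy (shiftDrawing Γ k) V i j l := by
  refine ⟨isFace_of_frontier_subset hV hne hd (hf ▸ image_subset_range _ _), hb.1, hb.2.1,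
    hb.2.2.1, ?_⟩
  rw [hf, cycle3, image_union, image_union]

/-- A non-polar face remains a face. -/
theorem face_shiftDrawing_of_isNonPolar (h : IsTriangulation Γ) (hn : 4 ≤ n)
    (hk : IsAdmissible Γ k) {U : Set S2} {i j l : Fin n} (hU : IsFace Γ U)
    (hb : BoundedBy Γ U i j l) (hp : IsNonPolar U)
    (ho' : orient (pos (shiftDrawing Γ k) i).1 (pos (shiftDrawing Γ k) j).1
      (pos (shiftDrawing Γ k) l).1 ≠ 0) {x : S2}
    (hx : x ∈ openTri (pos (shiftDrawing Γ k) i) (pos (shiftDrawing Γ k) j)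
      (pos (shiftDrawing Γ k) l)) :
    ∃ V, IsFace (shiftDrawing Γ k) V ∧ BoundedBy (shiftDrawing Γ k) V i j l ∧ x ∈ V := by
  have hfr := frontier_openTri ho'
  have himg := h.image_cycle3_shiftDrawing hn hk hb ho'
  obtain ⟨hUt, hN, hS⟩ := h.face_eq_of_isNonPolar hn hU hb hp
  have hNS := (h.pole_mem_closedTri_shiftDrawing_iff hn (h.orient_ne hb) ho').not.2
    (not_or.2 ⟨hN, hS⟩)
  rw [not_or] at hNS
  obtain ⟨hF, hB⟩ := face_of_frontier hb (isPreconnected_openTri ho') ⟨x, hx⟩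
    (by
      rintro _ hy ⟨w, rfl⟩
      have hwc : w ∉ cycle3 G i j l := fun hw => by
        have := mem_image_of_mem (shiftDrawing Γ k) hw
        rw [himg] at this
        exact this.2 hy
      -- A drawn point inside the new triangle has cycle points above and below it. The order on the
      -- longitude is the same in `Γ`, so the point would already have been inside the old face.
      have hex : ∀ P : S2, P = northPole ∨ P = southPole → ∃ u ∈ cycle3 G i j l,
          Above P.1 (Γ w).1 (Γ u).1 := by
        intro P hP
        have hPn : P ∉ closedTri (pos (shiftDrawing Γ k) i) (pos (shiftDrawing Γ k) j)
          (pos (shiftDrawing Γ k) l) := by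
          rcases hP with rfl | rfl
          exacts [hNS.1, hNS.2]
        obtain ⟨z, hz, hza⟩ := exists_above_frontier hP (h.offAxis_shiftDrawing hn k w) hy
          (fun hc => hPn (openTri_subset_closedTri hc)) (by rw [hfr]; exact fun hc => hc.2 hy)
          (by rw [hfr]; exact fun hc => hPn hc.1)
        rw [hfr, ← himg] at hz
        obtain ⟨u, hu, rfl⟩ := hz
        exact ⟨u, hu, (h.above_shiftDrawing_iff hn hk hP).1 hza⟩
      obtain ⟨u, hu, hua⟩ := hex _ (Or.inl rfl)
      obtain ⟨v, hv, hva⟩ := hex _ (Or.inr rfl)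
      rw [southPole_coe, above_neg] at hva
      have hmem := image_cycle3 h.toDrawing hb.1 hb.2.1 hb.2.2.1 (h.orient_ne hb)
      have hu' := mem_image_of_mem Γ hu
      have hv' := mem_image_of_mem Γ hv
      rw [hmem] at hu' hv'
      have hw : Γ w ∈ closedTri (pos Γ i) (pos Γ j) (pos Γ l) :=
        mem_closedCone_of_between hua hva hu'.1 hv'.1
      by_cases hwo : Γ w ∈ openTri (pos Γ i) (pos Γ j) (pos Γ l)
      · rw [← hUt] at hwo
        exact hU.subset hwo (mem_range_self w)
      · have : Γ w ∈ Γ '' cycle3 G i j l := by rw [hmem]; exact ⟨hw, hwo⟩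
        exact hwc (h.injective.mem_set_image.1 this))
    (hfr.trans himg.symm)
  exact ⟨_, hF, hB, hx⟩

/-- A point outside the cycle of a polar face is separated from the pole by the cycle. -/
theorem exists_above_cycle3 (h : IsTriangulation Γ) (hn : 4 ≤ n) {U : Set S2} {i j l : Fin n}
    (hU : IsFace Γ U) (hb : BoundedBy Γ U i j l) {P : S2} (hP : P = northPole ∨ P = southPole)
    (hPU : P ∈ U) {w : Realization G} (hw : w ∉ cycle3 G i j l) :
    ∃ u ∈ cycle3 G i j l, Above P.1 (Γ w).1 (Γ u).1 := by
  have hwU : Γ w ∉ U := fun hc => hU.subset hc (mem_range_self w)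
  obtain ⟨z, hz, hza⟩ := exists_above_frontier (S := Uᶜ) hP (h.offAxis hn w) hwU
    (fun hc => hc hPU)
    (by
      rw [frontier_compl, hb.frontier_eq]
      exact fun hc => hw (h.injective.mem_set_image.1 hc))
    (by
      rw [frontier_compl, hb.frontier_eq]
      exact fun hc => hU.subset hPU (image_subset_range _ _ hc))
  rw [frontier_compl, hb.frontier_eq] at hz
  obtain ⟨u, hu, rfl⟩ := hz
  exact ⟨u, hu, hza⟩

theorem neg_pole {P : S2} (hP : P = northPole ∨ P = southPole) :
    -P = northPole ∨ -P = southPole := by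
  rcases hP with rfl | rfl
  · exact Or.inr rfl
  · exact Or.inl (neg_neg _)

/-- The face that contains a pole remains a face. -/
theorem face_shiftDrawing_of_pole_mem (h : IsTriangulation Γ) (hn : 4 ≤ n)
    (hk : IsAdmissible Γ k) {U : Set S2} {i j l : Fin n} (hU : IsFace Γ U)
    (hb : BoundedBy Γ U i j l) {P : S2} (hP : P = northPole ∨ P = southPole) (hPU : P ∈ U)
    (ho' : orient (pos (shiftDrawing Γ k) i).1 (pos (shiftDrawing Γ k) j).1
      (pos (shiftDrawing Γ k) l).1 ≠ 0) :
    ∃ V, IsFace (shiftDrawing Γ k) V ∧ BoundedBy (shiftDrawing Γ k) V i j l ∧ P ∈ V := by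
  have himg := h.image_cycle3_shiftDrawing hn hk hb ho'
  have hPr := h.pole_notMem_range_shiftDrawing hn k hP
  have hex : ∀ {Q : S2}, (Q = northPole ∨ Q = southPole) → Q ∈ U → ∀ {w}, w ∉ cycle3 G i j l →
      ∃ u ∈ cycle3 G i j l,
        Above Q.1 (shiftDrawing Γ k w).1 (shiftDrawing Γ k u).1 := by
    intro Q hQ hQU w hw
    obtain ⟨u, hu, hua⟩ := h.exists_above_cycle3 hn hU hb hQ hQU hw
    exact ⟨u, hu, (h.above_shiftDrawing_iff hn hk hQ).2 hua⟩
  by_cases hPo : P ∈ openTri (pos (shiftDrawing Γ k) i) (pos (shiftDrawing Γ k) j)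
      (pos (shiftDrawing Γ k) l)
  · obtain ⟨hF, hB⟩ := face_of_frontier hb (isPreconnected_openTri ho') ⟨P, hPo⟩
      (by
        rintro _ hy ⟨w, rfl⟩
        have hwc : w ∉ cycle3 G i j l := fun hw => by
          have := mem_image_of_mem (shiftDrawing Γ k) hw
          rw [himg] at this
          exact this.2 hy
        -- The cycle point `u` between `w` and `P` would be a sum of interior points, hence off the
        -- boundary.
        obtain ⟨u, hu, ρ, δ, hρ, hδ, e⟩ := hex hP hPU hwc
        have hu' := mem_image_of_mem (shiftDrawing Γ k) hu
        rw [himg] at hu'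
        refine hu'.2 ((smul_mem_openCone_iff hρ).1 ?_)
        rw [e]
        exact openCone_add_closedCone hy
          (smul_mem_closedCone (openCone_subset_closedCone hPo) hδ.le))
      ((frontier_openTri ho').trans himg.symm)
    exact ⟨_, hF, hB, hPo⟩
  have hPc : P ∉ closedTri (pos (shiftDrawing Γ k) i) (pos (shiftDrawing Γ k) j)
      (pos (shiftDrawing Γ k) l) := fun hc => by
    have : P ∈ shiftDrawing Γ k '' cycle3 G i j l := by rw [himg]; exact ⟨hc, hPo⟩
    exact hPr (image_subset_range _ _ this)
  obtain ⟨hF, hB⟩ := face_of_frontier hb (isPreconnected_compl_closedTri ho') ⟨P, hPc⟩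
    (by
      rintro _ hy ⟨w, rfl⟩
      have hwc : w ∉ cycle3 G i j l := fun hw => by
        have := mem_image_of_mem (shiftDrawing Γ k) hw
        rw [himg] at this
        exact hy this.1
      have hcl : ∀ {u}, u ∈ cycle3 G i j l → (shiftDrawing Γ k u).1 ∈
          closedCone (pos (shiftDrawing Γ k) i).1 (pos (shiftDrawing Γ k) j).1
            (pos (shiftDrawing Γ k) l).1 := fun {u} hu => by
        have hu' := mem_image_of_mem (shiftDrawing Γ k) hu
        rw [himg] at hu'
        exact hu'.1
      obtain ⟨u, hu, hua⟩ := hex hP hPU hwc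
      -- If the small triangle contains the other pole, `w` is a combination of `u` and `-P`.
      -- Otherwise it contains no pole, before or after the shift; then `U` was the complement of
      -- the old triangle and contained both poles, so `w` lies between two cycle points.
      by_cases hPn : -P ∈ closedTri (pos (shiftDrawing Γ k) i) (pos (shiftDrawing Γ k) j)
          (pos (shiftDrawing Γ k) l)
      · obtain ⟨ρ, δ, hρ, hδ, e⟩ := hua
        apply hy
        show (shiftDrawing Γ k w).1 ∈ closedCone (pos (shiftDrawing Γ k) i).1
          (pos (shiftDrawing Γ k) j).1 (pos (shiftDrawing Γ k) l).1
        rw [show (shiftDrawing Γ k w).1 = ρ • (shiftDrawing Γ k u).1 + δ • -P.1 by rw [e]; module]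
        exact closedCone_add (smul_mem_closedCone (hcl hu) hρ.le) (smul_mem_closedCone hPn hδ.le)
      · have hNS := (h.pole_mem_closedTri_shiftDrawing_iff hn (h.orient_ne hb) ho').not.1 (by
          rw [not_or]
          rcases hP with rfl | rfl
          · exact ⟨hPc, hPn⟩
          · exact ⟨by simpa [southPole] using hPn, hPc⟩)
        rw [not_or] at hNS
        have hQ : ∀ {Q : S2}, Q = northPole ∨ Q = southPole →
            Q ∉ closedTri (pos Γ i) (pos Γ j) (pos Γ l) := by
          rintro Q (rfl | rfl)
          exacts [hNS.1, hNS.2]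
        have hUc := (h.face_eq hU hb).resolve_left fun e =>
          hQ hP (openTri_subset_closedTri (e ▸ hPU))
        obtain ⟨v, hv, hva⟩ := hex (neg_pole hP) (hUc ▸ hQ (neg_pole hP)) hwc
        have hva : Above (-P.1) _ _ := hva
        rw [above_neg] at hva
        exact hy (mem_closedCone_of_between hua hva (hcl hu) (hcl hv)))
    ((frontier_compl_closedTri ho').trans himg.symm)
  exact ⟨_, hF, hB, hPc⟩

/-- Every point off the shifted drawing lies in a face bounded by three edges. -/
theorem exists_face_shiftDrawing (h : IsTriangulation Γ) (hn : 4 ≤ n) (hk : IsAdmissible Γ k)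
    (ho : ∀ u v w, u ≠ v → v ≠ w → u ≠ w → orient (pos (shiftDrawing Γ k) u).1
      (pos (shiftDrawing Γ k) v).1 (pos (shiftDrawing Γ k) w).1 ≠ 0)
    {x : S2} (hx : x ∉ range (shiftDrawing Γ k)) :
    ∃ V i j l, IsFace (shiftDrawing Γ k) V ∧ BoundedBy (shiftDrawing Γ k) V i j l ∧ x ∈ V := by
  -- A point that sees a pole along its longitude lies in the face of that pole.
  have hpole : ∀ P : S2, (P = northPole ∨ P = southPole) →
      (x = P ∨ OffAxis x.1 ∧ ∀ w, ¬ Above P.1 x.1 (shiftDrawing Γ k w).1) →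
      ∃ V i j l, IsFace (shiftDrawing Γ k) V ∧ BoundedBy (shiftDrawing Γ k) V i j l ∧ x ∈ V := by
    intro P hP hxP
    have hPr : P ∈ (range Γ)ᶜ := by
      rcases hP with rfl | rfl
      exacts [h.northPole_notMem hn, h.southPole_notMem hn]
    have hU : IsFace Γ (connectedComponentIn (range Γ)ᶜ P) := ⟨P, hPr, rfl⟩
    obtain ⟨i, j, l, hb⟩ := h.faces _ hU
    obtain ⟨V, hF, hB, hPV⟩ := h.face_shiftDrawing_of_pole_mem hn hk hU hb hP
      (mem_connectedComponentIn hPr) (ho i j l hb.1.ne hb.2.1.ne hb.2.2.1.ne')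
    refine ⟨V, i, j, l, hF, hB, ?_⟩
    rcases hxP with rfl | ⟨hxo, hno⟩
    · exact hPV
    by_contra hxV
    have hfr : ∀ y, y ∉ range (shiftDrawing Γ k) → y ∉ frontier Vᶜ := fun y hy hc => by
      rw [frontier_compl, hB.frontier_eq] at hc
      exact hy (image_subset_range _ _ hc)
    obtain ⟨z, hz, hza⟩ := exists_above_frontier (S := Vᶜ) hP hxo hxV (fun hc => hc hPV)
      (hfr x hx) (hfr P (h.pole_notMem_range_shiftDrawing hn k hP))
    rw [frontier_compl, hB.frontier_eq] at hz
    obtain ⟨u, -, rfl⟩ := hz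
    exact hno u hza
  by_cases hxo : OffAxis x.1
  swap
  · rcases eq_pole_of_not_offAxis hxo with e | e
    · exact hpole _ (Or.inl rfl) (Or.inl e)
    · exact hpole _ (Or.inr rfl) (Or.inl e)
  by_cases h1 : ∀ w, ¬ Above (northPole : S2).1 x.1 (shiftDrawing Γ k w).1
  · exact hpole _ (Or.inl rfl) (Or.inr ⟨hxo, h1⟩)
  by_cases h2 : ∀ w, ¬ Above (southPole : S2).1 x.1 (shiftDrawing Γ k w).1
  · exact hpole _ (Or.inr rfl) (Or.inr ⟨hxo, h2⟩)
  push Not at h1 h2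
  obtain ⟨w', hw'⟩ := h1
  obtain ⟨w, hw⟩ := h2
  rw [southPole_coe, above_neg] at hw
  have hiff := fun {w w'} => h.above_shiftDrawing_iff hn hk (Or.inl rfl) (w := w) (w' := w')
  simp only [northPole_coe] at hw' hiff
  -- Now `x` lies between two drawn points. Narrow to consecutive ones, whose common non-polar face
  -- then contains `x` after the shift.
  refine h.above_induction hn (R := fun w w' => Above axis (shiftDrawing Γ k w).1 x.1 →
    Above axis x.1 (shiftDrawing Γ k w').1 → ∃ V i j l, IsFace (shiftDrawing Γ k) V ∧
      BoundedBy (shiftDrawing Γ k) V i j l ∧ x ∈ V) ?_ ?_ (hiff.1 (hw.trans hw')) hw hw'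
  · intro w w' ha hc hw hw'
    obtain ⟨U, i, j, l, hU, hb, hp, hwc, hwc'⟩ := h.exists_face_of_consecutive hn ha hc
    have ho' := ho i j l hb.1.ne hb.2.1.ne hb.2.2.1.ne'
    have himg := h.image_cycle3_shiftDrawing hn hk hb ho'
    have h1 := mem_image_of_mem (shiftDrawing Γ k) hwc
    have h2 := mem_image_of_mem (shiftDrawing Γ k) hwc'
    rw [himg] at h1 h2
    have hxc : x ∈ closedTri _ _ _ := mem_closedCone_of_between hw' hw h2.1 h1.1
    have hxop : x ∈ openTri (pos (shiftDrawing Γ k) i) (pos (shiftDrawing Γ k) j)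
        (pos (shiftDrawing Γ k) l) := by
      by_contra hc
      have : x ∈ shiftDrawing Γ k '' cycle3 G i j l := by rw [himg]; exact ⟨hxc, hc⟩
      exact hx (image_subset_range _ _ this)
    obtain ⟨V, hF, hB, hxV⟩ := h.face_shiftDrawing_of_isNonPolar hn hk hU hb hp ho' hxop
    exact ⟨V, i, j, l, hF, hB, hxV⟩
  · intro w y w' h1 h2 R1 R2 hw hw'
    have hs : SameSide x.1 (shiftDrawing Γ k y).1 :=
      (hw.sameSide.symm).trans (hiff.2 h1).sameSide
    rcases hs.trichotomy with ht | ⟨s, hs, e⟩ | ht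
    · exact R1 hw ht
    · exact (hx ⟨y, S2.eq_of_smul hs e⟩).elim
    · exact R2 ht hw'

theorem isTriangulation_shiftDrawing (h : IsTriangulation Γ) (hn : 4 ≤ n) (hk : IsAdmissible Γ k)
    (ho : ∀ u v w, u ≠ v → v ≠ w → u ≠ w → orient (pos (shiftDrawing Γ k) u).1
      (pos (shiftDrawing Γ k) v).1 (pos (shiftDrawing Γ k) w).1 ≠ 0) :
    IsTriangulation (shiftDrawing Γ k) where
  toIsShortestPathEmbedding := h.embedding_shiftDrawing hn hk
  generic := ho
  generic_poles u v huv := h.orient_axis_shiftDrawing_ne hn k huv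
  faces U hU := by
    obtain ⟨x, hx, rfl⟩ := hU
    obtain ⟨V, i, j, l, ⟨y, hy, rfl⟩, hB, hxV⟩ := h.exists_face_shiftDrawing hn hk ho hx
    exact ⟨i, j, l, connectedComponentIn_eq hxV ▸ hB⟩

end IsTriangulation

/-! ## Morphs preserve the rotation system -/

theorem pos_iff_of_forall_ne_zero {f : unitInterval → ℝ} (hf : Continuous f)
    (h0 : ∀ t, f t ≠ 0) : 0 < f 0 ↔ 0 < f 1 := by
  have key : ∀ a b, 0 < f a → 0 < f b := fun a b ha => by
    by_contra! hb
    obtain ⟨t, ht⟩ := mem_range_of_exists_le_of_exists_ge hf ⟨b, hb⟩ ⟨a, ha.le⟩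
    exact h0 t ht
  exact ⟨key _ _, key _ _⟩

theorem inner_eq_coord (a b : E3) : inner ℝ a b = a 0 * b 0 + a 1 * b 1 + a 2 * b 2 := by
  simp [PiLp.inner_apply, Fin.sum_univ_three]; ring

theorem orient_sq_of_orthogonal {a b c : E3} (hab : inner ℝ a b = 0) (hac : inner ℝ a c = 0)
    (hbc : inner ℝ b c = 0) :
    orient a b c ^ 2 = inner ℝ a a * inner ℝ b b * inner ℝ c c := by
  -- The squared determinant is the Gram determinant.
  have gram : orient a b c ^ 2 =
      inner ℝ a a * (inner ℝ b b * inner ℝ c c - inner ℝ b c * inner ℝ b c)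
        - inner ℝ a b * (inner ℝ a b * inner ℝ c c - inner ℝ b c * inner ℝ a c)
        + inner ℝ a c * (inner ℝ a b * inner ℝ b c - inner ℝ b b * inner ℝ a c) := by
    simp only [orient_eq, inner_eq_coord]; ring
  rw [gram, hab, hac, hbc]; ring

/-- Three distinct unit vectors of a plane are not collinear. -/
theorem orient_sub_ne_zero {u α β γ : E3} (hu : u ≠ 0) (hα : ‖α‖ = 1) (hβ : ‖β‖ = 1)
    (hγ : ‖γ‖ = 1) (uα : inner ℝ u α = 0) (uβ : inner ℝ u β = 0) (uγ : inner ℝ u γ = 0)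
    (hαβ : α ≠ β) (hαγ : α ≠ γ) (hβγ : β ≠ γ) : orient u (β - α) (γ - α) ≠ 0 := by
  intro h0
  set d := β - α with hd
  set e := γ - α with he
  have hd0 : d ≠ 0 := sub_ne_zero.2 hαβ.symm
  have hdd : inner ℝ d d ≠ 0 := inner_self_ne_zero.2 hd0
  -- Removing from `e` its projection on `d` leaves a vector orthogonal to `u` and `d`; the
  -- vanishing determinant forces it to be zero, so `e = r • d`.
  set r := inner ℝ d e / inner ℝ d d with hr
  have hud : inner ℝ u d = 0 := by rw [hd, inner_sub_right, uα, uβ, sub_zero]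
  have hue : inner ℝ u e = 0 := by rw [he, inner_sub_right, uα, uγ, sub_zero]
  have h1 : inner ℝ u (e - r • d) = 0 := by
    rw [inner_sub_right, inner_smul_right, hud, hue]; simp
  have h2 : inner ℝ d (e - r • d) = 0 := by
    rw [inner_sub_right, inner_smul_right, hr, div_mul_cancel₀ _ hdd, sub_self]
  have h3 : orient u d (e - r • d) = 0 := by
    rw [sub_eq_add_neg, ← neg_smul, orient_add_right, orient_smul_right, h0, orient_self_right]
    simp
  have h4 := orient_sq_of_orthogonal hud h1 h2
  rw [h3, zero_pow two_ne_zero, eq_comm, mul_eq_zero, mul_eq_zero] at h4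
  have h5 : e - r • d = 0 :=
    inner_self_eq_zero.1 (h4.resolve_left (not_or.2 ⟨inner_self_ne_zero.2 hu, hdd⟩))
  have hβ' : β = α + d := by rw [hd]; abel
  have hγ' : γ = α + r • d := by rw [← sub_eq_zero.1 h5, he]; abel
  have n1 : inner ℝ α α = 1 := by rw [real_inner_self_eq_norm_sq, hα]; norm_num
  have n2 : inner ℝ β β = 1 := by rw [real_inner_self_eq_norm_sq, hβ]; norm_num
  have n3 : inner ℝ γ γ = 1 := by rw [real_inner_self_eq_norm_sq, hγ]; norm_num
  rw [hβ', real_inner_add_add_self, n1] at n2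
  rw [hγ', real_inner_add_add_self, n1, inner_smul_right, inner_smul_left, inner_smul_right] at n3
  simp only [conj_trivial] at n3
  -- A line meets the unit sphere at most twice: `r = 0` or `r = 1`.
  have h6 : r * (r - 1) * inner ℝ d d = 0 := by linear_combination n3 - r * n2
  rcases mul_eq_zero.1 ((mul_eq_zero.1 h6).resolve_right hdd) with h7 | h7
  · exact hαγ (by rw [hγ', h7]; simp)
  · exact hβγ (by rw [hγ', sub_eq_zero.1 h7, one_smul, ← hβ'])

/-- The component of `a` orthogonal to the unit vector `u` does not vanish. -/
theorem tangent_ne_zero {u a : S2} (h1 : u ≠ a) (h2 : u ≠ -a) :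
    a.1 - inner ℝ u.1 a.1 • u.1 ≠ 0 := by
  intro h
  have e : a.1 = inner ℝ u.1 a.1 • u.1 := sub_eq_zero.1 h
  rcases lt_trichotomy (inner ℝ u.1 a.1 : ℝ) 0 with hc | hc | hc
  · apply h2
    refine S2.eq_of_smul (neg_pos.2 hc) ?_
    rw [neg_smul, ← e]; rfl
  · rw [hc, zero_smul] at e; exact a.ne_zero e
  · exact h1 (S2.eq_of_smul hc e.symm)

theorem norm_direction {u a : S2} (h1 : u ≠ a) (h2 : u ≠ -a) : ‖direction u a‖ = 1 := by
  have := norm_ne_zero_iff.2 (tangent_ne_zero h1 h2)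
  rw [direction, norm_smul, norm_inv, norm_norm, inv_mul_cancel₀ this]

theorem inner_direction (u a : S2) : inner ℝ u.1 (direction u a) = 0 := by
  have : ‖u.1‖ = 1 := norm_eq_of_mem_sphere u
  rw [direction, inner_smul_right, inner_sub_right, inner_smul_right, real_inner_self_eq_norm_sq,
    this]
  simp

theorem IsShortestPathEmbedding.pos_injective (h : IsShortestPathEmbedding Γ) :
    Function.Injective (pos Γ) := by
  intro u v e
  have := h.injective e
  have h1 := vertex_apply_self (G := G) u
  rw [this] at h1
  by_contra hne
  simp [vertex, hne] at h1

theorem IsShortestPathEmbedding.pos_mem_arc (h : IsShortestPathEmbedding Γ) {u v x : Fin n}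
    (huv : G.Adj u v) (hx : pos Γ x ∈ arc (pos Γ u) (pos Γ v)) : x = u ∨ x = v := by
  rw [← h.edge_eq_arc u v huv] at hx
  exact vertex_mem_edge_iff.1 (h.injective.mem_set_image.1 hx)

/-- Two arcs leaving `u` in one direction are nested, so one far end would lie on the other edge.
The sign of the `u`-coefficient of `a` in terms of `b` and `u` tells which arc is shorter. -/
theorem IsShortestPathEmbedding.direction_ne (h : IsShortestPathEmbedding Γ) {u a b : Fin n}
    (ha : G.Adj u a) (hb : G.Adj u b) (hab : a ≠ b) :
    direction (pos Γ u) (pos Γ a) ≠ direction (pos Γ u) (pos Γ b) := by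
  intro e
  have hne : ∀ {c}, G.Adj u c →
      (pos Γ c).1 - inner ℝ (pos Γ u).1 (pos Γ c).1 • (pos Γ u).1 ≠ 0 := fun {c} hc =>
    tangent_ne_zero (fun e => hc.ne (h.pos_injective e)) (h.not_antipodal _ _ hc)
  have ha0 := norm_pos_iff.2 (hne ha)
  have hb0 := norm_pos_iff.2 (hne hb)
  simp only [direction] at e
  set x := ‖(pos Γ a).1 - inner ℝ (pos Γ u).1 (pos Γ a).1 • (pos Γ u).1‖
  set y := ‖(pos Γ b).1 - inner ℝ (pos Γ u).1 (pos Γ b).1 • (pos Γ u).1‖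
  set p : ℝ := inner ℝ (pos Γ u).1 (pos Γ a).1
  set q : ℝ := inner ℝ (pos Γ u).1 (pos Γ b).1
  have key : (pos Γ a).1 = (x * y⁻¹) • (pos Γ b).1 + (p - x * y⁻¹ * q) • (pos Γ u).1 := by
    have e' := congrArg (x • ·) e
    simp only [smul_smul, mul_inv_cancel₀ ha0.ne', one_smul] at e'
    rw [sub_eq_iff_eq_add.1 e']; module
  have hr : 0 < x * y⁻¹ := by positivity
  rcases le_total 0 (p - x * y⁻¹ * q) with hμ | hμ
  · rcases h.pos_mem_arc hb ⟨_, _, hμ, hr.le, by rw [key, add_comm]⟩ with e | e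
    exacts [ha.ne' e, hab e]
  · refine (h.pos_mem_arc (x := b) ha ⟨(x * y⁻¹)⁻¹ * -(p - x * y⁻¹ * q), (x * y⁻¹)⁻¹,
      mul_nonneg (inv_nonneg.2 hr.le) (neg_nonneg.2 hμ), inv_nonneg.2 hr.le, ?_⟩).elim
      (fun e => hb.ne' e) (fun e => hab e.symm)
    rw [key, smul_add, smul_smul, inv_mul_cancel₀ hr.ne']; module

/-- At every time the directions of distinct neighbours are distinct unit tangent vectors, so the
determinant defining their cyclic order never vanishes and keeps its sign. -/
theorem IsMorph.isomorphic {H : unitInterval × Realization G → S2} {Γ' : Realization G → S2}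
    (hH : IsMorph H Γ Γ') : Isomorphic Γ Γ' := by
  intro u a b c hua hub huc
  by_cases hab : a = b
  · subst hab; simp [IsCcwAround, orient_eq]
  by_cases hbc : b = c
  · subst hbc; simp [IsCcwAround]
  by_cases hac : a = c
  · subst hac; simp [IsCcwAround, orient_eq]
  have hc : ∀ v, Continuous fun t => (pos (fun w => H (t, w)) v).1 := fun v =>
    continuous_subtype_val.comp (hH.continuous.comp (Continuous.prodMk_left _))
  have hne : ∀ {v}, G.Adj u v → ∀ t,
      pos (fun w => H (t, w)) u ≠ pos (fun w => H (t, w)) v := fun hv t e =>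
    hv.ne ((hH.embedding t).pos_injective e)
  have hdir : ∀ {v}, G.Adj u v → Continuous fun t =>
      direction (pos (fun w => H (t, w)) u) (pos (fun w => H (t, w)) v) := by
    intro v hv
    simp only [direction]
    have h1 := (hc v).sub (((hc u).inner (𝕜 := ℝ) (hc v)).smul (hc u))
    exact (h1.norm.inv₀ fun t => norm_ne_zero_iff.2
      (tangent_ne_zero (hne hv t) ((hH.embedding t).not_antipodal _ _ hv))).smul h1
  have hf : Continuous fun t => orient (pos (fun w => H (t, w)) u).1
      (direction (pos (fun w => H (t, w)) u) (pos (fun w => H (t, w)) b) -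
        direction (pos (fun w => H (t, w)) u) (pos (fun w => H (t, w)) a))
      (direction (pos (fun w => H (t, w)) u) (pos (fun w => H (t, w)) c) -
        direction (pos (fun w => H (t, w)) u) (pos (fun w => H (t, w)) a)) :=
    continuous_orient (hc u) ((hdir hub).sub (hdir hua)) ((hdir huc).sub (hdir hua))
  have key := pos_iff_of_forall_ne_zero hf fun t => by
      have he := hH.embedding t
      have hn := fun {v} (hv : G.Adj u v) => norm_direction (hne hv t) (he.not_antipodal _ _ hv)
      exact orient_sub_ne_zero (S2.ne_zero _) (hn hua) (hn hub) (hn huc) (inner_direction _ _)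
        (inner_direction _ _) (inner_direction _ _) (he.direction_ne hua hub hab)
        (he.direction_ne hua huc hac) (he.direction_ne hub huc hbc)
  have e0 : (fun w => H (0, w)) = Γ := funext hH.source
  have e1 : (fun w => H (1, w)) = Γ' := funext hH.target
  simpa only [e0, e1] using! key

/-! ## From a weak triangulation to a morph -/

theorem orient_shift (k : Fin n → ℝ) (i j l : Fin n) :
    orient (shift Γ k i) (shift Γ k j) (shift Γ k l) =
      orient (pos Γ i).1 (pos Γ j).1 (pos Γ l).1 +
        (k i * orient axis (pos Γ j).1 (pos Γ l).1 + k j * orient axis (pos Γ l).1 (pos Γ i).1 +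
          k l * orient axis (pos Γ i).1 (pos Γ j).1) := orient_add_axis _ _ _ _ _ _

/-- Affine dependence on the shift becomes linear interpolation along the segment from `0` to `k`.
-/
theorem orient_shift_smul (k : Fin n → ℝ) (t : ℝ) (i j l : Fin n) :
    orient (shift Γ (t • k) i) (shift Γ (t • k) j) (shift Γ (t • k) l) =
      (1 - t) * orient (pos Γ i).1 (pos Γ j).1 (pos Γ l).1 +
        t * orient (shift Γ k i) (shift Γ k j) (shift Γ k l) := by
  simp only [orient_shift, Pi.smul_apply, smul_eq_mul]; ring

theorem continuous_orient_shift (i j l : Fin n) :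
    Continuous fun k => orient (shift Γ k i) (shift Γ k j) (shift Γ k l) := by
  simp only [orient_shift]; fun_prop

theorem IsTriangulation.isAdmissible_smul (h : IsTriangulation Γ) {k : Fin n → ℝ}
    (hk : IsAdmissible Γ k) {t : ℝ} (h0 : 0 ≤ t) (h1 : t ≤ 1) : IsAdmissible Γ (t • k) := by
  intro U i j l hU hb hp
  have hD := mul_self_pos.2 (h.orient_ne hb)
  have hk := hk U i j l hU hb hp
  rw [orient_shift_smul]
  rcases h0.eq_or_lt with rfl | h0
  · simpa using hD
  · nlinarith [mul_nonneg (sub_nonneg.2 h1) hD.le, mul_pos h0 hk]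

theorem isOpen_isAdmissible (Γ : Realization G → S2) : IsOpen {k | IsAdmissible Γ k} := by
  have : {k | IsAdmissible Γ k} = ⋂ p : Fin n × Fin n × Fin n,
      {k | (∃ U, IsFace Γ U ∧ BoundedBy Γ U p.1 p.2.1 p.2.2 ∧ IsNonPolar U) →
        0 < orient (pos Γ p.1).1 (pos Γ p.2.1).1 (pos Γ p.2.2).1 *
          orient (shift Γ k p.1) (shift Γ k p.2.1) (shift Γ k p.2.2)} := by
    ext k
    simp only [IsAdmissible, mem_iInter, mem_ofPred_eq, Prod.forall]
    exact ⟨fun h i j l ⟨U, h1, h2, h3⟩ => h U i j l h1 h2 h3,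
      fun h U i j l h1 h2 h3 => h i j l ⟨U, h1, h2, h3⟩⟩
  rw [this]
  refine isOpen_iInter_of_finite fun p => ?_
  by_cases hp : ∃ U, IsFace Γ U ∧ BoundedBy Γ U p.1 p.2.1 p.2.2 ∧ IsNonPolar U
  · simp only [hp, true_imp_iff]
    exact isOpen_lt continuous_const (continuous_const.mul (continuous_orient_shift _ _ _))
  · simp [hp]

/-- The shifts in general position are dense. -/
theorem IsTriangulation.dense_generic (h : IsTriangulation Γ) :
    Dense {k : Fin n → ℝ | ∀ u v w, u ≠ v → v ≠ w → u ≠ w →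
      orient (shift Γ k u) (shift Γ k v) (shift Γ k w) ≠ 0} := by
  let ι := {p : Fin n × Fin n × Fin n // p.1 ≠ p.2.1 ∧ p.2.1 ≠ p.2.2 ∧ p.1 ≠ p.2.2}
  have : {k : Fin n → ℝ | ∀ u v w, u ≠ v → v ≠ w → u ≠ w →
      orient (shift Γ k u) (shift Γ k v) (shift Γ k w) ≠ 0} =
      ⋂ p : ι, {k | orient (shift Γ k p.1.1) (shift Γ k p.1.2.1) (shift Γ k p.1.2.2) ≠ 0} := by
    ext k
    simp only [mem_iInter, mem_ofPred_eq]
    exact ⟨fun h p => h _ _ _ p.2.1 p.2.2.1 p.2.2.2,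
      fun h u v w h1 h2 h3 => h ⟨(u, v, w), h1, h2, h3⟩⟩
  rw [this]
  refine dense_iInter_of_isOpen
    (fun p => isOpen_ne_fun (continuous_orient_shift _ _ _) continuous_const) ?_
  rintro ⟨⟨u, v, w⟩, h1, h2, h3⟩ k
  dsimp only at h1 h2 h3 ⊢
  by_cases hk : orient (shift Γ k u) (shift Γ k v) (shift Γ k w) = 0
  swap
  · exact subset_closure hk
  -- Shifting `u` alone changes the determinant at the nonzero rate `orient axis (pos Γ v).1 (pos Γ
  -- w).1`.
  have hc : Continuous fun ε : ℝ => k + ε • (Pi.single u 1 : Fin n → ℝ) := by fun_prop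
  have ht : Tendsto (fun ε : ℝ => k + ε • (Pi.single u 1 : Fin n → ℝ)) (𝓝[≠] 0) (𝓝 k) := by
    have := hc.tendsto 0
    rw [zero_smul, add_zero] at this
    exact this.mono_left nhdsWithin_le_nhds
  refine mem_closure_of_tendsto ht ?_
  filter_upwards [self_mem_nhdsWithin] with ε hε
  have : orient (shift Γ (k + ε • Pi.single u 1) u) (shift Γ (k + ε • Pi.single u 1) v)
      (shift Γ (k + ε • Pi.single u 1) w) = ε * orient axis (pos Γ v).1 (pos Γ w).1 := by
    rw [orient_shift] at hk ⊢
    simp only [Pi.add_apply, Pi.smul_apply, smul_eq_mul, Pi.single_eq_same,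
      Pi.single_eq_of_ne h1.symm, Pi.single_eq_of_ne h3.symm]
    linear_combination hk
  show orient _ _ _ ≠ 0
  rw [this]
  exact mul_ne_zero hε (h.orient_axis_ne h2)

/-- A weakly admissible southern shift can be perturbed to an admissible one in general
position. -/
theorem IsTriangulation.exists_generic_shift (h : IsTriangulation Γ) {k : Fin n → ℝ}
    (hk : ∀ U i j l, IsFace Γ U → BoundedBy Γ U i j l → IsNonPolar U →
      0 ≤ orient (pos Γ i).1 (pos Γ j).1 (pos Γ l).1 *
        orient (shift Γ k i) (shift Γ k j) (shift Γ k l))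
    (hs : ∀ v, (pos Γ v).1 2 + k v < 0) :
    ∃ k', IsAdmissible Γ k' ∧ (∀ v, (pos Γ v).1 2 + k' v < 0) ∧
      ∀ u v w, u ≠ v → v ≠ w → u ≠ w →
        orient (shift Γ k' u) (shift Γ k' v) (shift Γ k' w) ≠ 0 := by
  -- Being southern is open, so it survives scaling by some `s < 1`; the weight `1 - s` on the
  -- original determinants makes the weak inequalities strict.
  have hev : ∀ᶠ s : ℝ in 𝓝 1, ∀ v, (pos Γ v).1 2 + s * k v < 0 := by
    refine eventually_all.2 fun v => ?_
    have hc : Continuous fun s : ℝ => (pos Γ v).1 2 + s * k v := by fun_prop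
    exact hc.continuousAt.eventually_lt continuousAt_const (by simpa using hs v)
  have hpos : ∀ᶠ s : ℝ in 𝓝 1, 0 < s := eventually_gt_nhds one_pos
  obtain ⟨s, ⟨hs1, hs0⟩, hlt⟩ := (((hev.and hpos).filter_mono nhdsWithin_le_nhds).and
    (self_mem_nhdsWithin (s := Iio (1 : ℝ)))).exists
  have hlt : s < 1 := hlt
  have hadm : IsAdmissible Γ (s • k) := by
    intro U i j l hU hb hp
    have hD := mul_self_pos.2 (h.orient_ne hb)
    have hk := hk U i j l hU hb hp
    rw [orient_shift_smul]
    nlinarith [mul_pos (sub_pos.2 hlt) hD, mul_nonneg hs0.le hk]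
  have hopen : IsOpen {k' : Fin n → ℝ | ∀ v, (pos Γ v).1 2 + k' v < 0} := by
    simp only [ofPred_forall]
    exact isOpen_iInter_of_finite fun v =>
      isOpen_lt (continuous_const.add (continuous_apply v)) continuous_const
  obtain ⟨k', ⟨h1, h2⟩, h3⟩ := h.dense_generic.inter_open_nonempty _
    ((isOpen_isAdmissible Γ).inter hopen) ⟨s • k, hadm, by simpa using hs1⟩
  exact ⟨k', h1, h2, h3⟩

theorem IsTriangulation.sinkable_of_admissible (h : IsTriangulation Γ) (hn : 4 ≤ n)
    {k : Fin n → ℝ} (hk : IsAdmissible Γ k) (hs : ∀ v, (pos Γ v).1 2 + k v < 0)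
    (hg : ∀ u v w, u ≠ v → v ≠ w → u ≠ w →
      orient (shift Γ k u) (shift Γ k v) (shift Γ k w) ≠ 0) : Sinkable Γ := by
  have hadm : ∀ t : unitInterval, IsAdmissible Γ ((t : ℝ) • k) := fun t =>
    h.isAdmissible_smul hk t.2.1 t.2.2
  have hemb : ∀ t : unitInterval, IsShortestPathEmbedding (shiftDrawing Γ ((t : ℝ) • k)) :=
    fun t => h.embedding_shiftDrawing hn (hadm t)
  have hmorph : IsMorph
      (fun p : unitInterval × Realization G => shiftDrawing Γ ((p.1 : ℝ) • k) p.2) Γ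
      (shiftDrawing Γ k) :=
    { continuous := h.continuous_shiftDrawing_smul hn k
      source := fun w => by simp [shiftDrawing_zero]
      target := fun w => by simp
      embedding := hemb }
  refine ⟨shiftDrawing Γ k, h.isTriangulation_shiftDrawing hn hk fun u v w h1 h2 h3 => ?_,
    ⟨hmorph.isomorphic, fun v => h.sameLongitude_shiftDrawing hn k _⟩, fun v => ?_, _,
    { toIsMorph := hmorph
      same_longitude := fun t v => h.sameLongitude_shiftDrawing hn _ _ }⟩
  · obtain ⟨r, hr, e⟩ := h.exists_orient_pos hn k u v w
    rw [e]
    exact mul_ne_zero hr.ne' (hg u v w h1 h2 h3)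
  · obtain ⟨r, hr, e⟩ := h.exists_pos_shiftDrawing hn k v
    rw [e]
    simpa [shift, mul_add] using mul_neg_of_pos_of_neg hr (hs v)

theorem mul_nonneg_of_sign_eq {x y : ℝ}
    (h : y ≠ 0 → SignType.sign y = SignType.sign x) : 0 ≤ x * y := by
  rcases lt_trichotomy y 0 with hy | rfl | hy
  · have := h hy.ne
    rw [sign_neg hy, eq_comm, sign_eq_neg_one_iff] at this
    exact (mul_pos_of_neg_of_neg this hy).le
  · simp
  · have := h hy.ne'
    rw [sign_pos hy, eq_comm, sign_eq_one_iff] at this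
    exact (mul_pos this hy).le

/-- Vertices on common longitudes differ by a shift up to positive scaling, and equality of signs on
nondegenerate non-polar faces says exactly that this shift is weakly admissible. -/
theorem IsTriangulation.sinkable_of_weak (h : IsTriangulation Γ) (hn : 4 ≤ n)
    {Γ' : Realization G → S2} (hθ : WeakThetaEquivalent Γ Γ') (hs : IsSouthern Γ') :
    Sinkable Γ := by
  choose ρ k hρ e using fun v => (hθ.1 v).exists_smul
  have e : ∀ v, shift Γ k v = ρ v • (pos Γ' v).1 := fun v => (e v).symm
  obtain ⟨k', h1, h2, h3⟩ := h.exists_generic_shift (k := k) (fun U i j l hU hb hp => by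
      rw [e, e, e, orient_smul_left, orient_smul_mid, orient_smul_right,
        show ∀ x y z s t : ℝ, s * (x * (y * (z * t))) = x * y * z * (s * t) by intros; ring]
      exact mul_nonneg (mul_pos (mul_pos (hρ i) (hρ j)) (hρ l)).le
        (mul_nonneg_of_sign_eq (hθ.2 U i j l hU hb hp)))
    (fun v => by
      have h2 := congrArg (fun x : E3 => x 2) (e v)
      simp only [shift] at h2
      simp only [PiLp.add_apply, PiLp.smul_apply, smul_eq_mul] at h2
      have h4 := mul_neg_of_pos_of_neg (hρ v) (hs v)
      rw [← h2] at h4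
      simpa using h4)
  exact h.sinkable_of_admissible hn h1 h2 h3

variable {Γ' : Realization G → S2}

/-! ## From a morph to a weak triangulation -/

theorem SameSide.exists_orient_axis {a a' b b' : E3} (ha : SameSide a a') (hb : SameSide b b') :
    ∃ r : ℝ, 0 < r ∧ orient axis a b = r * orient axis a' b' := by
  obtain ⟨ρ, δ, hρ, e⟩ := ha
  obtain ⟨ρ', δ', hρ', e'⟩ := hb
  obtain ⟨h0, h1, -⟩ := smul_eq_add_axis_iff.1 e
  obtain ⟨h0', h1', -⟩ := smul_eq_add_axis_iff.1 e'
  refine ⟨ρ * ρ', by positivity, ?_⟩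
  rw [orient_axis, orient_axis, ← h0, ← h1, ← h0', ← h1']; ring

/-- Solving the dependency for the point whose coefficient has the odd sign gives nonnegative
coefficients on the other two. -/
theorem mem_arc_of_comb {a b c : S2} {x y z : ℝ} (hy : x * y < 0) (hz : x * z < 0)
    (h : x • a.1 + y • b.1 + z • c.1 = 0) : a ∈ arc b c := by
  have hx : x ≠ 0 := by rintro rfl; simp at hy
  have hxx : 0 < x * x := mul_self_pos.2 hx
  refine ⟨-(x * y) / (x * x), -(x * z) / (x * x), div_nonneg (by linarith) hxx.le,
    div_nonneg (by linarith) hxx.le, ?_⟩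
  have h' : a.1 = (-(x⁻¹ * y)) • b.1 + (-(x⁻¹ * z)) • c.1 := by
    have h2 := congrArg (x⁻¹ • ·) h
    simp only [smul_add, smul_smul, inv_mul_cancel₀ hx, one_smul, smul_zero] at h2
    exact sub_eq_zero.1 (Eq.trans (by module) h2)
  rw [h']
  congr 2 <;> field_simp

/-- Three reals that are neither all non-negative nor all non-positive, and none of them zero:
one has a sign different from the two others. -/
theorem exists_opposite {x y z : ℝ} (hx : x ≠ 0) (hy : y ≠ 0) (hz : z ≠ 0)
    (h1 : ¬ (0 ≤ x ∧ 0 ≤ y ∧ 0 ≤ z)) (h2 : ¬ (x ≤ 0 ∧ y ≤ 0 ∧ z ≤ 0)) :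
    (x * y < 0 ∧ x * z < 0) ∨ (y * z < 0 ∧ y * x < 0) ∨ (z * x < 0 ∧ z * y < 0) := by
  simp only [mul_neg_iff]
  rcases lt_or_gt_of_ne hx with hx | hx <;> rcases lt_or_gt_of_ne hy with hy | hy <;>
    rcases lt_or_gt_of_ne hz with hz | hz <;> simp [hx, hy, hz]
  · exact (h2 ⟨hx.le, hy.le, hz.le⟩).elim
  · exact (h1 ⟨hx.le, hy.le, hz.le⟩).elim

namespace IsTriangulation

/-- A non-polar face does not degenerate in an embedding with the same longitudes. -/
theorem orient_ne_zero_of_isNonPolar (h : IsTriangulation Γ) (hn : 4 ≤ n)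
    (h' : IsShortestPathEmbedding Γ') (hs : ∀ v, SameLongitude (pos Γ v) (pos Γ' v))
    {U : Set S2} {i j l : Fin n} (hU : IsFace Γ U) (hb : BoundedBy Γ U i j l)
    (hp : IsNonPolar U) : orient (pos Γ' i).1 (pos Γ' j).1 (pos Γ' l).1 ≠ 0 := by
  intro h0
  obtain ⟨-, hN, hS⟩ := h.face_eq_of_isNonPolar hn hU hb hp
  have hNS := (pole_mem_closedTri_iff (h.orient_ne hb)).not.1 (not_or.2 ⟨hN, hS⟩)
  rw [not_or] at hNS
  -- Without a pole in the triangle, the three axis determinants have mixed signs. In a degenerate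
  -- position they are the coefficients of a linear dependency between the corners, so the odd one
  -- out lies on the opposite edge.
  have hop := exists_opposite (h.orient_axis_ne hb.2.1.ne) (h.orient_axis_ne hb.2.2.1.ne)
    (h.orient_axis_ne hb.1.ne) hNS.1 hNS.2
  obtain ⟨r1, h1, e1⟩ := (hs j).exists_smul.exists_orient_axis (hs l).exists_smul
  obtain ⟨r2, h2, e2⟩ := (hs l).exists_smul.exists_orient_axis (hs i).exists_smul
  obtain ⟨r3, h3, e3⟩ := (hs i).exists_smul.exists_orient_axis (hs j).exists_smul
  rw [e1, e2, e3] at hop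
  have hm : ∀ {r s x y : ℝ}, 0 < r → 0 < s → r * x * (s * y) < 0 → x * y < 0 := by
    intro r s x y hr hs hxy
    rw [show r * x * (s * y) = r * s * (x * y) by ring] at hxy
    exact (pos_iff_neg_of_mul_neg hxy).1 (mul_pos hr hs)
  have hc := orient_smul_eq (pos Γ' i).1 (pos Γ' j).1 (pos Γ' l).1 axis
  rw [h0, zero_smul, eq_comm] at hc
  rcases hop with ⟨ha, hb'⟩ | ⟨ha, hb'⟩ | ⟨ha, hb'⟩
  · rcases h'.pos_mem_arc hb.2.1 (mem_arc_of_comb (hm h1 h2 ha) (hm h1 h3 hb') hc) with e | e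
    exacts [hb.1.ne e, hb.2.2.1.ne' e]
  · rcases h'.pos_mem_arc (x := j) hb.2.2.1 (mem_arc_of_comb (hm h2 h3 ha) (hm h2 h1 hb')
      (Eq.trans (by abel) hc)) with e | e
    exacts [hb.2.1.ne e, hb.1.ne' e]
  · rcases h'.pos_mem_arc (x := l) hb.1 (mem_arc_of_comb (hm h3 h1 ha) (hm h3 h2 hb')
      (Eq.trans (by abel) hc)) with e | e
    exacts [hb.2.2.1.ne e, hb.2.1.ne' e]

/-- A longitudinal morph preserves the orientation of non-polar faces. -/
theorem orient_pos_iff_of_morph (h : IsTriangulation Γ) (hn : 4 ≤ n)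
    {H : unitInterval × Realization G → S2} (hH : IsLongitudinalMorph H Γ Γ')
    {U : Set S2} {i j l : Fin n} (hU : IsFace Γ U) (hb : BoundedBy Γ U i j l)
    (hp : IsNonPolar U) : 0 < orient (pos Γ i).1 (pos Γ j).1 (pos Γ l).1 ↔
      0 < orient (pos Γ' i).1 (pos Γ' j).1 (pos Γ' l).1 := by
  have hc : ∀ v, Continuous fun t => (pos (fun w => H (t, w)) v).1 := fun v =>
    continuous_subtype_val.comp (hH.continuous.comp (Continuous.prodMk_left _))
  have key := pos_iff_of_forall_ne_zero (continuous_orient (hc i) (hc j) (hc l)) fun t =>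
    h.orient_ne_zero_of_isNonPolar hn (hH.embedding t) (hH.same_longitude t) hU hb hp
  have e0 : (fun w => H (0, w)) = Γ := funext hH.source
  have e1 : (fun w => H (1, w)) = Γ' := funext hH.target
  simpa only [e0, e1] using key

/-- A face with counterclockwise corners is the small triangle or its complement according to the
orientation of its corners. -/
theorem face_eq_of_isCcwFace (h : IsTriangulation Γ) {U : Set S2} {i j l : Fin n}
    (hU : IsCcwFace Γ U i j l) :
    (0 < orient (pos Γ i).1 (pos Γ j).1 (pos Γ l).1 ∧
        U = openTri (pos Γ i) (pos Γ j) (pos Γ l)) ∨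
      (orient (pos Γ i).1 (pos Γ j).1 (pos Γ l).1 < 0 ∧
        U = (closedTri (pos Γ i) (pos Γ j) (pos Γ l))ᶜ) := by
  obtain ⟨hF, hb, hl, -, -⟩ := hU
  have hD := h.orient_ne hb
  set D := orient (pos Γ i).1 (pos Γ j).1 (pos Γ l).1 with hDdef
  have hm0 : (pos Γ i).1 + (pos Γ j).1 ≠ 0 := fun e => by
    refine h.not_antipodal _ _ hb.1 (Subtype.ext ?_)
    exact eq_neg_of_add_eq_zero_left e
  obtain ⟨r, hr, er⟩ := exists_radial hm0
  set m := radial ((pos Γ i).1 + (pos Γ j).1)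
  have hm : m ∈ openArc (pos Γ i) (pos Γ j) := ⟨r, r, hr, hr, by rw [er, smul_add]⟩
  have hcl : m ∈ closure {x : S2 | 0 < orient (pos Γ i).1 (pos Γ j).1 x.1 ∧
      (0 < D → x ∈ openTri (pos Γ i) (pos Γ j) (pos Γ l)) ∧
      (D < 0 → x ∉ closedTri (pos Γ i) (pos Γ j) (pos Γ l))} := by
    -- Moving the edge's midpoint towards or away from `l`, by the sign of `D`, always enters its
    -- left side, so the point reached is in the face.
    refine mem_closure_of_radial (v := D • (pos Γ l).1) fun ε hε h0 => ?_
    obtain ⟨s, hs, es⟩ := exists_radial h0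
    have hDD := mul_self_pos.2 hD
    have hpos : orient (pos Γ i).1 (pos Γ j).1 (radial (m.1 + ε • D • (pos Γ l).1)).1 =
        s * ε * (D * D) := by
      rw [es, er]
      simp only [orient_smul_right, orient_add_right, orient_self_outer, orient_self_right]
      rw [← hDdef]; ring
    refine ⟨?_, fun hD' => ?_, fun hD' hc => ?_⟩
    · rw [hpos]; positivity
    · refine ⟨s * r, s * r, s * (ε * D), by positivity, by positivity, by positivity, ?_⟩
      rw [es, er]; module
    · have := ((mem_closedCone_iff hD).1 hc).2.2
      rw [orient_cycle (radial _).1, hpos] at this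
      exact this.not_gt (mul_neg_of_neg_of_pos hD' (by positivity))
  obtain ⟨x, ⟨hx1, hx2, hx3⟩, hx4⟩ :=
    ((mem_closure_iff_frequently.1 hcl).and_eventually (hl m hm)).exists
  have hxU := hx4 hx1
  rcases lt_or_gt_of_ne hD with hD' | hD'
  · refine Or.inr ⟨hD', (h.face_eq hF hb).resolve_left fun e => ?_⟩
    rw [e] at hxU
    exact hx3 hD' (openTri_subset_closedTri hxU)
  · refine Or.inl ⟨hD', (h.face_eq hF hb).resolve_right fun e => ?_⟩
    rw [e] at hxU
    exact hxU (openTri_subset_closedTri (hx2 hD'))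

/-- A face that contains only the south pole winds clockwise around the axis. -/
theorem orient_axis_neg_of_southPole_mem (h : IsTriangulation Γ) (hn : 4 ≤ n) {U : Set S2}
    {i j l : Fin n} (hU : IsCcwFace Γ U i j l) (hN : northPole ∉ U) (hS : southPole ∈ U) :
    orient axis (pos Γ j).1 (pos Γ l).1 < 0 ∧ orient axis (pos Γ l).1 (pos Γ i).1 < 0 ∧
      orient axis (pos Γ i).1 (pos Γ j).1 < 0 := by
  have hD := h.orient_ne hU.2.1
  have hneg : ∀ x y : E3, orient (-axis) x y = -orient axis x y := fun x y => by
    rw [← neg_one_smul ℝ axis, orient_smul_left]; ring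
  rcases h.face_eq_of_isCcwFace hU with ⟨hD', e⟩ | ⟨hD', e⟩
  · rw [e] at hS
    have hS : -axis ∈ openCone _ _ _ := hS
    rw [mem_openCone_iff hD] at hS
    simpa only [hneg, mul_pos_iff_of_pos_left hD', Left.neg_pos_iff] using hS
  · rw [e, mem_compl_iff, not_not] at hN
    have hN : axis ∈ openCone _ _ _ := h.pole_mem_openTri hn hU.2.1 (Or.inl rfl) hN
    rw [mem_openCone_iff hD] at hN
    exact ⟨neg_of_mul_pos_right hN.1 hD'.le, neg_of_mul_pos_right hN.2.1 hD'.le,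
      neg_of_mul_pos_right hN.2.2 hD'.le⟩

theorem corners_eq (h : IsTriangulation Γ) {U : Set S2} {i j l a b c : Fin n}
    (h1 : BoundedBy Γ U i j l) (h2 : BoundedBy Γ U a b c) :
    ({i, j, l} : Set (Fin n)) = {a, b, c} := by
  have e : cycle3 G i j l = cycle3 G a b c :=
    h.injective.image_injective (h1.frontier_eq.symm.trans h2.frontier_eq)
  ext x
  simp only [mem_insert_iff, mem_singleton_iff]
  rw [← vertex_mem_cycle3_iff (G := G), ← vertex_mem_cycle3_iff (G := G), e]

/-- The exceptional triple is the face of the north pole. Any other face is either non-polar, where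
the morph preserves its sign, or contains just the south pole, where `orient_expand_axis` is a sum
of products of negative numbers. -/
theorem noInvertedFaces_of_morph (h : IsTriangulation Γ) (hn : 4 ≤ n)
    {H : unitInterval × Realization G → S2} (hH : IsLongitudinalMorph H Γ Γ')
    (hlong : ∀ v, SameLongitude (pos Γ v) (pos Γ' v)) (hs : IsSouthern Γ') :
    NoInvertedFaces Γ Γ' := by
  have hPr : northPole ∈ (range Γ)ᶜ := h.northPole_notMem hn
  obtain ⟨a, b, c, hb⟩ := h.faces _ ⟨northPole, hPr, rfl⟩
  refine ⟨a, b, c, fun U i j l hU hne => ?_⟩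
  have hN : northPole ∉ U := fun hN => by
    obtain ⟨⟨x, hx, rfl⟩, hbU, -⟩ := hU
    rw [connectedComponentIn_eq hN] at hbU
    exact hne (h.corners_eq hbU hb)
  by_cases hS : southPole ∈ U
  · obtain ⟨h1, h2, h3⟩ := h.orient_axis_neg_of_southPole_mem hn hU hN hS
    have hneg : ∀ {x y}, orient axis (pos Γ x).1 (pos Γ y).1 < 0 →
        orient axis (pos Γ' x).1 (pos Γ' y).1 < 0 := fun {x y} hxy => by
      obtain ⟨r, hr, e⟩ := (hlong x).exists_smul.exists_orient_axis (hlong y).exists_smul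
      rw [e] at hxy
      exact (pos_iff_neg_of_mul_neg hxy).1 hr
    rw [orient_expand_axis]
    have := mul_pos_of_neg_of_neg (hs i) (hneg h1)
    have := mul_pos_of_neg_of_neg (hs j) (hneg h2)
    have := mul_pos_of_neg_of_neg (hs l) (hneg h3)
    positivity
  · refine ((h.orient_pos_iff_of_morph hn hH hU.1 hU.2.1 ⟨hN, hS⟩).1 ?_).le
    rcases h.face_eq_of_isCcwFace hU with ⟨hD, -⟩ | ⟨-, e⟩
    · exact hD
    · rw [e, mem_compl_iff, not_not] at hN hS
      exact (not_both_poles_mem (h.orient_ne hU.2.1)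
        (h.pole_mem_openTri hn hU.2.1 (Or.inl rfl) hN) hS).elim

end IsTriangulation

/-- A common point of two open edges comes from one point of the realization with nonzero weight at
all four ends, so the two edges have the same ends. -/
theorem IsTriangulation.noCrossingEdges (h : IsTriangulation Γ) : NoCrossingEdges Γ := by
  rintro u v x y huv hxy ⟨z, hz, hz'⟩
  have key : ∀ {u v : Fin n}, G.Adj u v → z ∈ openArc (pos Γ u) (pos Γ v) →
      ∃ w ∈ edge G u v, Γ w = z ∧ w.1 u ≠ 0 ∧ w.1 v ≠ 0 := by
    rintro u v huv ⟨s, t, hs, ht, e⟩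
    have hmem : z ∈ arc (pos Γ u) (pos Γ v) := ⟨s, t, hs.le, ht.le, e⟩
    rw [← h.edge_eq_arc u v huv] at hmem
    obtain ⟨w, hw, rfl⟩ := hmem
    have hno := h.orient_axis_ne huv.ne
    have hno' := h.orient_axis_ne huv.ne'
    refine ⟨w, hw, rfl, fun h0 => ?_, fun h0 => ?_⟩
    · rw [mem_edge_self_of_eq_zero hw h0] at e
      have := congrArg (fun x => orient axis x (pos Γ v).1) e
      simp only [orient_add_mid, orient_smul_mid, orient_self_right] at this
      change orient axis (pos Γ v).1 (pos Γ v).1 = _ at this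
      rw [orient_self_right, mul_zero, add_zero, eq_comm] at this
      exact hno ((mul_eq_zero.1 this).resolve_left hs.ne')
    · rw [mem_edge_self_of_eq_zero (by rwa [edge_comm]) h0] at e
      have := congrArg (fun x => orient axis x (pos Γ u).1) e
      simp only [orient_add_mid, orient_smul_mid, orient_self_right] at this
      change orient axis (pos Γ u).1 (pos Γ u).1 = _ at this
      rw [orient_self_right, mul_zero, zero_add, eq_comm] at this
      exact hno' ((mul_eq_zero.1 this).resolve_left ht.ne')
  obtain ⟨w, hw, ew, h1, h2⟩ := key huv hz
  obtain ⟨w', hw', ew', h3, h4⟩ := key hxy hz'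
  obtain rfl := h.injective (ew.trans ew'.symm)
  rcases hw x h3 with rfl | rfl <;> rcases hw y h4 with rfl | rfl <;> simp

/-- The southern end of the morph is itself the weak triangulation. -/
theorem IsTriangulation.exists_weak_of_sinkable (h : IsTriangulation Γ) (hn : 4 ≤ n)
    (hs : Sinkable Γ) : ∃ Γ' : Realization G → S2, IsWeakTriangulation Γ Γ' ∧
      WeakThetaEquivalent Γ Γ' ∧ IsSouthern Γ' := by
  obtain ⟨Γ', h', ⟨-, hlong⟩, hsouth, H, hH⟩ := hs
  refine ⟨Γ', ⟨h'.toDrawing, h.noInvertedFaces_of_morph hn hH hlong hsouth, h'.noCrossingEdges⟩,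
    ⟨hlong, fun U i j l hU hb hp hne => ?_⟩, hsouth⟩
  have hiff := h.orient_pos_iff_of_morph hn hH hU hb hp
  rcases lt_or_gt_of_ne hne with h1 | h1
  · rw [sign_neg h1, sign_neg]
    exact lt_of_le_of_ne (not_lt.1 fun hc => h1.not_gt (hiff.1 hc)) (h.orient_ne hb)
  · rw [sign_pos h1, sign_pos (hiff.2 h1)]

end SphereDrawing

theorem corollaryC {n : ℕ} (hn : 4 ≤ n) (G : SimpleGraph (Fin n))
    (Γ : SphereDrawing.Realization G → SphereDrawing.S2)
    (hΓ : SphereDrawing.IsTriangulation Γ) :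
    SphereDrawing.Sinkable Γ ↔
      ∃ Γ' : SphereDrawing.Realization G → SphereDrawing.S2,
        SphereDrawing.IsWeakTriangulation Γ Γ' ∧
        SphereDrawing.WeakThetaEquivalent Γ Γ' ∧
        SphereDrawing.IsSouthern Γ' :=
  ⟨hΓ.exists_weak_of_sinkable hn, fun ⟨_, _, hθ, hs⟩ => hΓ.sinkable_of_weak hn hθ hs⟩
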